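/- Consider the linear time-invariant system $$X(t+1)=AX(t)+V(t)\in\mathbb{R}^{n_x},\qquad Y(t)=CX(t)+W(t)\in\mathbb{R}^{n_y},\qquad t=0,1,2,\dots,$$ where $(C,A)$ is observable and $A$ has at least one eigenvalue of magnitude greater than one. *Channel.* A finite-state uncertain channel has a finite input alphabet $\mathcal X$ with $q=|\mathcal X|$, an output alphabet $\mathcal Y$, a finite nonempty state set $\mathcal S$ and, for each $s\in\mathcal S$, $x\in\mathcal X$, a nonempty set $T(s,x)\subseteq\mathcal Y\times\mathcal S$: if the channel is in state $s(t)$ and its input is $x(t)$, then the pair (output, next state) can be any element of $T(s(t),x(t))$, irrespective of the past; the initial state $s(0)\in\mathcal S$ is arbitrary and unknown. A zero-error code of length $n+1$ is a set $\mathcal F\subseteq\mathcal X^{n+1}$ such that no two distinct elements of $\mathcal F$ can result in the same output block, for any initial states and any channel behaviour. All logarithms are in base $q$, and the zero-error capacity is $C_0=\sup \frac{\log|\mathcal F|}{n+1}$ over all $n\ge 0$ and all zero-error codes $\mathcal F$ of length $n+1$. *Coder-estimator.* A coder-estimator consists of maps giving the channel input $D(t)=\zeta(t,Y(0),\dots,Y(t))\in\mathcal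 X$ and, from the channel outputs $Q(0),Q(1),\dots$, the estimates $\hat X(0)=0$, $\hat X(t+1)=\eta(t,Q(0),\dots,Q(t))\in\mathbb{R}^{n_x}$. It yields uniformly bounded estimation errors if for any uniformly bounded sets $\mathcal V$, $\mathcal W$ of noise signals $V$, $W$, each containing the zero signal, there is $l>0$ such that for every set $\mathcal I\subseteq\{x:\|x\|\le l\}$ of initial conditions $$\sup\|\hat X(t)-X(t)\|<\infty,$$ where the supremum is over all $t\ge 0$, all $X(0)\in\mathcal I$, $V\in\mathcal V$, $W\in\mathcal W$ (in any combination) and all possible channel responses to the resulting inputs. **Theorem.** Let $$h_{lin}=\sum_{|\lambda_i|\ge 1}\log|\lambda_i|,$$ the sum being over the eigenvalues $\lambda_i$ of $A$ counted with algebraic multiplicity, and suppose that $C_0>0$. If there exists a coder-estimator that yields uniformly bounded estimation errors, then $C_0\ge h_{lin}$. Conversely, if $C_0>h_{lin}$, then there exists a coder-estimator that yields uniformly bounded estimation errors. -/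

import Mathlib

namespace BoundedEstimation

/-! ### Finite-state uncertain channels and zero-error capacity -/

/-- A (time-invariant) finite-state uncertain channel with input alphabet `X`, output alphabet `Y`
and state set `S` (finite and nonempty where the channel is used).
`trans s x y s'` says that `(y, s')` lies in the conditional range
`⟦Y(t), S(t+1) | x(t) = x, s(t) = s⟧`; every input symbol may be sent in every state, so this range
is nonempty. -/
structure FiniteStateChannel (X Y S : Type*) where
  trans : S → X → Y → S → Prop
  range_nonempty : ∀ s x, ∃ y s', trans s x y s'

namespace FiniteStateChannel

variable {X Y S : Type*}

/-- The output block `y` can result from the input block `x`, for some initial state and some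
channel noise. -/
def CanOutput (ch : FiniteStateChannel X Y S) {m : ℕ} (x : Fin m → X) (y : Fin m → Y) : Prop :=
  ∃ s : Fin (m + 1) → S, ∀ i : Fin m, ch.trans (s i.castSucc) (x i) (y i) (s i.succ)

/-- The infinite output sequence `y` can result from the infinite input sequence `x`, for some
initial state and some channel noise. -/
def CanOutputSeq (ch : FiniteStateChannel X Y S) (x : ℕ → X) (y : ℕ → Y) : Prop :=
  ∃ s : ℕ → S, ∀ t, ch.trans (s t) (x t) (y t) (s (t + 1))

/-- A zero-error code: two distinct codewords can never result in the same output block,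
regardless of channel noise and initial states. -/
def IsZeroErrorCode (ch : FiniteStateChannel X Y S) {m : ℕ} (F : Finset (Fin m → X)) : Prop :=
  ∀ x ∈ F, ∀ x' ∈ F, x ≠ x' → ∀ y : Fin m → Y, ¬ (ch.CanOutput x y ∧ ch.CanOutput x' y)

/-- The zero-error capacity `C₀ = sup log_q |F| / (n + 1)`, over all `n ≥ 0` and all zero-error
codes `F` of length `n + 1`, where `q = |X|`. -/
noncomputable def zeroErrorCapacity [Fintype X] (ch : FiniteStateChannel X Y S) : ℝ :=
  sSup {r : ℝ | ∃ (n : ℕ) (F : Finset (Fin (n + 1) → X)), ch.IsZeroErrorCode F ∧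
    r = Real.logb (Fintype.card X) (F.card : ℝ) / ((n : ℝ) + 1)}

end FiniteStateChannel

/-! ### The linear system -/

variable {nx ny : ℕ}

/-- The pair `(C, A)` is observable: without disturbances, the initial state is determined by the
output sequence `C A ^ k x`, `k ≥ 0`. -/
def IsObservable (C : Matrix (Fin ny) (Fin nx) ℝ) (A : Matrix (Fin nx) (Fin nx) ℝ) : Prop :=
  Function.Injective fun (x : Fin nx → ℝ) (k : ℕ) => C.mulVec ((A ^ k).mulVec x)

/-- The complex eigenvalues of the real matrix `A`, with algebraic multiplicity. -/
noncomputable def eigenvalues (A : Matrix (Fin nx) (Fin nx) ℝ) : Multiset ℂ :=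
  (A.map (algebraMap ℝ ℂ)).charpoly.roots

/-- The topological entropy `∑_{|λᵢ| ≥ 1} log_q |λᵢ|` of the linear system. -/
noncomputable def linEntropy (q : ℕ) (A : Matrix (Fin nx) (Fin nx) ℝ) : ℝ :=
  (((eigenvalues A).filter fun z => 1 ≤ ‖z‖).map fun z => Real.logb q ‖z‖).sum

/-- The state `X(t)` of `X(t+1) = A X(t) + V(t)`. -/
def plantState (A : Matrix (Fin nx) (Fin nx) ℝ) (x₀ : Fin nx → ℝ) (v : ℕ → Fin nx → ℝ) :
    ℕ → Fin nx → ℝ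
  | 0 => x₀
  | t + 1 => A.mulVec (plantState A x₀ v t) + v t

/-- The output `Y(t) = C X(t) + W(t)`. -/
def plantOutput (A : Matrix (Fin nx) (Fin nx) ℝ) (C : Matrix (Fin ny) (Fin nx) ℝ)
    (x₀ : Fin nx → ℝ) (v : ℕ → Fin nx → ℝ) (w : ℕ → Fin ny → ℝ) (t : ℕ) : Fin ny → ℝ :=
  C.mulVec (plantState A x₀ v t) + w t

/-- A range of a noise signal (a set of signals) that is uniformly bounded and contains the zero
signal. -/
def IsAdmissibleNoise {n : ℕ} (N : Set (ℕ → Fin n → ℝ)) : Prop :=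
  (∃ b : ℝ, ∀ v ∈ N, ∀ t, ‖v t‖ ≤ b) ∧ 0 ∈ N

/-! ### Coder-estimators -/

/-- A causal coder `D(t) = ζ(t, Y(0:t))` and a causal estimator `X̂(t+1) = η(t, Q(0:t))`. -/
structure CoderEstimator (nx ny : ℕ) (X Y : Type*) where
  coder : (t : ℕ) → (Fin (t + 1) → Fin ny → ℝ) → X
  estimator : (t : ℕ) → (Fin (t + 1) → Y) → Fin nx → ℝ

namespace CoderEstimator

variable {X Y S : Type*}

/-- The channel inputs `D(t)` produced from the plant outputs. -/
def input (K : CoderEstimator nx ny X Y) (y : ℕ → Fin ny → ℝ) (t : ℕ) : X :=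
  K.coder t fun i => y i

/-- The state estimates `X̂(t)` produced from the channel outputs, with `X̂(0) = 0`. -/
def estimate (K : CoderEstimator nx ny X Y) (r : ℕ → Y) : ℕ → Fin nx → ℝ
  | 0 => 0
  | t + 1 => K.estimator t fun i => r i

/-- Uniformly bounded estimation errors: for all admissible noise ranges `NV`, `NW` there is
`l > 0` such that for every range `I` of initial conditions in the `l`-ball, the estimation error
is bounded, uniformly over all times and all valid realizations. As the initial condition, the two
noise signals and the channel errors are mutually unrelated, a valid realization is an arbitrary
combination of an initial condition in `I`, noise signals in `NV` and `NW`, and a possible response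
of the channel to the resulting input. -/
def UniformlyBoundedErrors (K : CoderEstimator nx ny X Y) (A : Matrix (Fin nx) (Fin nx) ℝ)
    (C : Matrix (Fin ny) (Fin nx) ℝ) (ch : FiniteStateChannel X Y S) : Prop :=
  ∀ (NV : Set (ℕ → Fin nx → ℝ)) (NW : Set (ℕ → Fin ny → ℝ)),
    IsAdmissibleNoise NV → IsAdmissibleNoise NW →
    ∃ l : ℝ, 0 < l ∧ ∀ I : Set (Fin nx → ℝ), I ⊆ Metric.closedBall 0 l →
      ∃ β : ℝ, ∀ x₀ ∈ I, ∀ v ∈ NV, ∀ w ∈ NW, ∀ r : ℕ → Y,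
        ch.CanOutputSeq (K.input (plantOutput A C x₀ v w)) r →
          ∀ t, ‖K.estimate r t - plantState A x₀ v t‖ ≤ β

end CoderEstimator

end BoundedEstimation

open BoundedEstimation

/-! Let `Au` be the block of `A` carrying the eigenvalues of modulus at least one. Then `h_lin = log
|det Au|`, so the theorem compares the volume growth of the unstable part with the number of
messages that can be sent without error.

Necessity (`linEntropy_le_zeroErrorCapacity`): without noise, initial conditions whose states at
time `n + 1` are more than twice the error bound apart must be told apart by the first `n + 1`
channel outputs, so their channel inputs form a zero-error code
(`exists_zeroErrorCode_of_separated`). By volume, a ball contains at least a constant times `|det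
Au| ^ (n + 1)` such points. The constant does not affect the rate as `n` grows.

Sufficiency (`exists_uniformlyBoundedErrors`): take a zero-error code with more than `|det Au| ^
length` words and repeat it `j` times. As `Au⁻¹` has no eigenvalue outside the closed unit disc, its
powers grow more slowly than any exponential, and a volume count gives a `1/2`-net of the image of
the unit ball under the matching power of `Au`, with at least one message to spare
(`exists_half_net_pow`). Sending a net point brings an error within the quantizer range back to half
the range, up to a bounded perturbation; the spare message announces an overflow. The coder does not
know the noise bounds, so each overflow enlarges the range, by a factor that outpaces the error;
hence overflows eventually stop (`quantizerRun_bounded`). The quantized vector is the unstable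
coordinate of a state reconstructed from finitely many outputs (`observer_bounded`); the stable
coordinate stays bounded and is estimated by zero at block starts. -/

namespace BoundedEstimation

open Polynomial

/-! ### Eigenvalues and growth of matrix powers -/

section Spectral

theorem mem_eigenvalues_iff {n : ℕ} (M : Matrix (Fin n) (Fin n) ℝ) (z : ℂ) :
    z ∈ eigenvalues M ↔ z ∈ spectrum ℂ (M.map (algebraMap ℝ ℂ)) := by
  rw [Matrix.mem_spectrum_iff_isRoot_charpoly, eigenvalues, mem_roots]
  exact (Matrix.charpoly_monic _).ne_zero

/-- If a real polynomial annihilates `M`, it vanishes at the eigenvalues of `M`. -/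
theorem aeval_eq_zero_of_mem_eigenvalues {n : ℕ} {M : Matrix (Fin n) (Fin n) ℝ} {p : ℝ[X]}
    (hp : aeval M p = 0) {z : ℂ} (hz : z ∈ eigenvalues M) : aeval z p = 0 := by
  have h0 : aeval (M.map (algebraMap ℝ ℂ)) (p.map (algebraMap ℝ ℂ)) = 0 := by
    rw [aeval_map_algebraMap]
    have := aeval_algHom_apply (Algebra.ofId ℝ ℂ).mapMatrix M p
    rw [hp, map_zero] at this
    exact this
  have h1 := spectrum.subset_polynomial_aeval (𝕜 := ℂ) (M.map (algebraMap ℝ ℂ))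
    (p.map (algebraMap ℝ ℂ)) ⟨z, (mem_eigenvalues_iff M z).1 hz, rfl⟩
  rw [h0] at h1
  -- The spectrum of zero is `{0}` only in a nontrivial algebra, so size zero is separate.
  rcases n with _ | n
  · rw [spectrum.of_subsingleton] at h1
    exact h1.elim
  · rw [spectrum.zero_eq] at h1
    simpa [eval_map_algebraMap] using h1

attribute [local instance] Matrix.linftyOpNormedRing Matrix.linftyOpNormedAlgebra in
/-- Powers of a real matrix whose complex eigenvalues have modulus less than `r` grow at most
like `r ^ n`. -/
theorem exists_norm_pow_mulVec_le {a : ℕ} (M : Matrix (Fin a) (Fin a) ℝ) {r : ℝ} (hr : 0 < r)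
    (h : ∀ z ∈ eigenvalues M, ‖z‖ < r) :
    ∃ c : ℝ, 0 < c ∧ ∀ (n : ℕ) (x : Fin a → ℝ), ‖(M ^ n).mulVec x‖ ≤ c * r ^ n * ‖x‖ := by
  rcases a with _ | a
  · refine ⟨1, one_pos, fun n x => ?_⟩
    have : (M ^ n).mulVec x = 0 := Subsingleton.elim _ _
    rw [this, norm_zero]; positivity
  set Mc := M.map (algebraMap ℝ ℂ) with hMc
  have : CompleteSpace (Matrix (Fin (a+1)) (Fin (a+1)) ℂ) := FiniteDimensional.complete ℂ _
  have hrad : spectralRadius ℂ Mc < ENNReal.ofReal r := by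
    have := spectrum.spectralRadius_lt_of_forall_lt (a := Mc) (r := r.toNNReal) (fun z hz => by
      rw [← NNReal.coe_lt_coe, Real.coe_toNNReal _ hr.le]
      exact h z ((mem_eigenvalues_iff M z).2 hz))
    exact this
  -- Gelfand's formula gives the bound `r ^ n` for all large `n`.
  have hG := spectrum.pow_norm_pow_one_div_tendsto_nhds_spectralRadius Mc
  have hev := hG.eventually (gt_mem_nhds hrad)
  obtain ⟨N, hN⟩ := Filter.eventually_atTop.1 hev
  have hlarge : ∀ n, N ≤ n → 1 ≤ n → ‖Mc ^ n‖ ≤ r ^ n := by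
    intro n hn hn1
    have h1 := (ENNReal.ofReal_lt_ofReal_iff hr).1 (hN n hn)
    have h2 := pow_le_pow_left₀ (by positivity) h1.le n
    rwa [one_div, Real.rpow_inv_natCast_pow (norm_nonneg _) (by omega)] at h2
  -- The `ℓ∞` operator norm depends only on the absolute values of the entries, hence is unchanged
  -- over `ℂ`.
  have hnorm : ∀ n, ‖M ^ n‖ = ‖Mc ^ n‖ := by
    intro n
    have : Mc ^ n = (M ^ n).map (algebraMap ℝ ℂ) := by
      rw [hMc]; exact (map_pow (algebraMap ℝ ℂ).mapMatrix M n).symm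
    rw [this, Matrix.linfty_opNorm_def, Matrix.linfty_opNorm_def]
    simp
  -- The sum absorbs the finitely many powers not covered by Gelfand's formula.
  refine ⟨1 + ∑ n ∈ Finset.range (N + 1), ‖M ^ n‖ / r ^ n, by positivity, fun n x => ?_⟩
  refine (Matrix.linfty_opNorm_mulVec _ _).trans ?_
  gcongr
  have hpos : 0 ≤ ∑ n ∈ Finset.range (N + 1), ‖M ^ n‖ / r ^ n := by positivity
  by_cases hn : n < N + 1
  · have h1 := Finset.single_le_sum (f := fun n => ‖M ^ n‖ / r ^ n) (fun i _ => by positivity)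
      (Finset.mem_range.2 hn)
    have h2 : ‖M ^ n‖ = ‖M ^ n‖ / r ^ n * r ^ n := by field_simp
    rw [h2]
    gcongr
    linarith
  · rw [hnorm]
    refine (hlarge n (by omega) (by omega)).trans ?_
    nlinarith [pow_pos hr n]

end Spectral

/-- The complex roots of a real irreducible polynomial all have the same modulus. -/
theorem norm_eq_of_irreducible {f : ℝ[X]} (hf : Irreducible f) {z w : ℂ}
    (hz : aeval z f = 0) (hw : aeval w f = 0) : ‖z‖ = ‖w‖ := by
  -- Roots with the same minimal polynomial are related by an automorphism of `ℂ` over `ℝ`: the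
  -- identity or conjugation, both of which preserve the modulus.
  have hconj : IsConjRoot ℝ w z := by
    rw [IsConjRoot, ← minpoly.eq_of_irreducible hf hz, ← minpoly.eq_of_irreducible hf hw]
  have : Normal ℝ ℂ := normal_iff.2 fun x =>
    ⟨Algebra.IsIntegral.isIntegral x, IsAlgClosed.splits _⟩
  obtain ⟨σ, rfl⟩ := isConjRoot_iff_exists_algEquiv.1 hconj
  rcases Complex.real_algHom_eq_id_or_conj σ.toAlgHom with h | h
  · have : σ z = z := DFunLike.congr_fun h z
    rw [this]
  · have : σ z = Complex.conjAe z := DFunLike.congr_fun h z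
    rw [this]
    simp

/-- A nonzero real polynomial splits into a factor whose complex roots lie outside the open unit
disc and a factor whose complex roots lie inside. -/
theorem exists_factor_unit_disc {p : ℝ[X]} (hp : p ≠ 0) :
    ∃ pu ps : ℝ[X], p = pu * ps ∧ (∀ z : ℂ, aeval z pu = 0 → 1 ≤ ‖z‖) ∧
      (∀ z : ℂ, aeval z ps = 0 → ‖z‖ < 1) := by
  induction p using UniqueFactorizationMonoid.induction_on_prime with
  | h₁ => exact absurd rfl hp
  | h₂ x hx =>
    refine ⟨x, 1, by simp, fun z hz => ?_, fun z hz => by simp at hz⟩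
    exact absurd hz (hx.map (aeval z)).ne_zero
  | h₃ a f ha hf ih =>
    obtain ⟨pu, ps, rfl, hu, hs⟩ := ih ha
    by_cases h : ∀ z : ℂ, aeval z f = 0 → 1 ≤ ‖z‖
    · refine ⟨f * pu, ps, by ring, fun z hz => ?_, hs⟩
      rw [map_mul, mul_eq_zero] at hz
      exact hz.elim (h z) (hu z)
    · push Not at h
      obtain ⟨w, hw, hw1⟩ := h
      refine ⟨pu, f * ps, by ring, hu, fun z hz => ?_⟩
      rw [map_mul, mul_eq_zero] at hz
      refine hz.elim (fun hz => ?_) (hs z)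
      rwa [norm_eq_of_irreducible hf.irreducible hz hw]

/-- Every real matrix is similar to a block diagonal matrix whose blocks carry the eigenvalues
outside and inside the open unit disc. -/
theorem exists_unstable_stable_decomposition {n : ℕ} (A : Matrix (Fin n) (Fin n) ℝ) :
    ∃ (a b : ℕ) (Au : Matrix (Fin a) (Fin a) ℝ) (As : Matrix (Fin b) (Fin b) ℝ)
      (L : (Fin n → ℝ) ≃ₗ[ℝ] (Fin a → ℝ) × (Fin b → ℝ)),
      (∀ x, L (A.mulVec x) = (Au.mulVec (L x).1, As.mulVec (L x).2)) ∧
      A.charpoly = Au.charpoly * As.charpoly ∧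
      (∀ z ∈ eigenvalues Au, 1 ≤ ‖z‖) ∧ (∀ z ∈ eigenvalues As, ‖z‖ < 1) := by
  obtain ⟨pu, ps, hp, hu, hs⟩ := exists_factor_unit_disc (Matrix.charpoly_monic A).ne_zero
  have hcop : IsCoprime pu ps := by
    rw [isCoprime_iff_aeval_ne_zero_of_isAlgClosed ℝ ℂ]
    intro z
    by_contra! hc
    exact absurd (hu z hc.1) (not_le.2 (hs z hc.2))
  set f : Module.End ℝ (Fin n → ℝ) := Matrix.toLin' A with hf
  have hfc : f.charpoly = A.charpoly := Matrix.charpoly_toLin' A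
  set Eu := LinearMap.ker (aeval f pu) with hEu
  set Es := LinearMap.ker (aeval f ps) with hEs
  -- Coprimality makes the kernels disjoint; by Cayley–Hamilton they span the space.
  have hcompl : IsCompl Eu Es := by
    refine ⟨disjoint_ker_aeval_of_isCoprime f hcop, codisjoint_iff.2 ?_⟩
    rw [sup_ker_aeval_eq_ker_aeval_mul_of_coprime f hcop, ← hp, ← hfc,
      LinearMap.aeval_self_charpoly, LinearMap.ker_zero]
  have hinv : ∀ p : ℝ[X], ∀ x ∈ LinearMap.ker (aeval f p), f x ∈ LinearMap.ker (aeval f p) := by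
    intro p x hx
    rw [LinearMap.mem_ker] at hx ⊢
    have h1 : (aeval f p) * f = f * aeval f p := by
      have := congrArg (aeval f) (mul_comm p X)
      simpa using this
    have := congrArg (fun g => g x) h1
    simpa [hx] using this
  set fu : Module.End ℝ Eu := f.restrict (hinv pu)
  set fs : Module.End ℝ Es := f.restrict (hinv ps)
  -- Each factor annihilates the restriction to its own kernel, which locates the eigenvalues of the
  -- two blocks.
  have hann : ∀ p : ℝ[X], aeval (f.restrict (hinv p)) p = 0 := by
    intro p
    have hcoe : ∀ (r : ℝ[X]) (x : LinearMap.ker (aeval f p)),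
        (aeval (f.restrict (hinv p)) r x : Fin n → ℝ) = aeval f r x := by
      intro r
      induction r using Polynomial.induction_on' with
      | add r₁ r₂ h₁ h₂ => intro x; simp [h₁, h₂]
      | monomial k c =>
        intro x
        simp only [aeval_monomial, Module.End.mul_apply, Module.algebraMap_end_apply,
          Submodule.coe_smul]
        congr 1
        induction k with
        | zero => simp
        | succ k ih => simp [pow_succ', ih]
    ext1 x
    apply Subtype.ext
    rw [hcoe]
    exact x.2
  let e := Submodule.prodEquivOfIsCompl Eu Es hcompl
  have hconj : ∀ x, f (e x) = e (fu x.1, fs x.2) := by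
    intro x
    simp [e, fu, fs]
  have hconj' : e.conj (fu.prodMap fs) = f := by
    refine LinearMap.ext fun x => ?_
    rw [LinearEquiv.conj_apply_apply, ← e.apply_symm_apply x, hconj]
    simp
  let bu := Module.finBasis ℝ Eu
  let bs := Module.finBasis ℝ Es
  have hmat : ∀ {k : ℕ} {E : Submodule ℝ (Fin n → ℝ)} (b : Module.Basis (Fin k) ℝ E)
      (g : Module.End ℝ E) (x : E),
      b.equivFun (g x) = (LinearMap.toMatrix b b g).mulVec (b.equivFun x) := by
    intro k E b g x
    exact (LinearMap.toMatrix_mulVec_repr b b g x).symm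
  have hroot : ∀ {k : ℕ} {E : Submodule ℝ (Fin n → ℝ)} (b : Module.Basis (Fin k) ℝ E)
      (g : Module.End ℝ E) {p : ℝ[X]}, aeval g p = 0 →
      ∀ z ∈ eigenvalues (LinearMap.toMatrix b b g), aeval z p = 0 := by
    intro k E b g p hg z hz
    refine aeval_eq_zero_of_mem_eigenvalues ?_ hz
    have := aeval_algHom_apply (LinearMap.toMatrixAlgEquiv b).toAlgHom g p
    rw [hg, map_zero] at this
    exact this
  refine ⟨_, _, LinearMap.toMatrix bu bu fu, LinearMap.toMatrix bs bs fs,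
    e.symm.trans (bu.equivFun.prodCongr bs.equivFun), fun x => ?_, ?_, fun z hz => ?_,
    fun z hz => ?_⟩
  · obtain ⟨y, rfl⟩ := e.surjective x
    have : A.mulVec (e y) = e (fu y.1, fs y.2) := hconj y
    rw [this]
    simp [hmat]
  · rw [← hfc, ← hconj', LinearEquiv.charpoly_conj, LinearMap.charpoly_prodMap,
      LinearMap.charpoly_toMatrix, LinearMap.charpoly_toMatrix]
  · exact hu z (hroot bu fu (hann pu) z hz)
  · exact hs z (hroot bs fs (hann ps) z hz)

theorem abs_det_eq_prod_norm_eigenvalues {n : ℕ} (M : Matrix (Fin n) (Fin n) ℝ) :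
    |M.det| = ((eigenvalues M).map fun z => ‖z‖).prod := by
  have h1 : (M.map (algebraMap ℝ ℂ)).det = (eigenvalues M).prod :=
    Matrix.det_eq_prod_roots_charpoly _
  have h2 : (M.map (algebraMap ℝ ℂ)).det = (M.det : ℂ) :=
    ((algebraMap ℝ ℂ).map_det M).symm
  rw [← Real.norm_eq_abs, ← Complex.norm_real, ← h2, h1]
  exact map_multiset_prod (normHom : ℂ →*₀ ℝ) _

theorem one_le_abs_det {n : ℕ} {M : Matrix (Fin n) (Fin n) ℝ}
    (h : ∀ z ∈ eigenvalues M, 1 ≤ ‖z‖) : 1 ≤ |M.det| := by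
  rw [abs_det_eq_prod_norm_eigenvalues]
  generalize eigenvalues M = s at h
  induction s using Multiset.induction_on with
  | empty => simp
  | cons z s ih =>
    rw [Multiset.map_cons, Multiset.prod_cons]
    exact one_le_mul_of_one_le_of_one_le (h z (by simp)) (ih fun w hw => h w (by simp [hw]))

/-- The filter keeps exactly the eigenvalues of the unstable block, and their moduli multiply to the
absolute determinant. This turns the spectral quantity into a volume factor. -/
theorem linEntropy_eq_logb_det {n a b : ℕ} {A : Matrix (Fin n) (Fin n) ℝ}
    {Au : Matrix (Fin a) (Fin a) ℝ} {As : Matrix (Fin b) (Fin b) ℝ}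
    (hch : A.charpoly = Au.charpoly * As.charpoly)
    (hu : ∀ z ∈ eigenvalues Au, 1 ≤ ‖z‖) (hs : ∀ z ∈ eigenvalues As, ‖z‖ < 1) (q : ℕ) :
    linEntropy q A = Real.logb q |Au.det| := by
  have heig : eigenvalues A = eigenvalues Au + eigenvalues As := by
    simp only [eigenvalues, Matrix.charpoly_map]
    rw [hch, Polynomial.map_mul, roots_mul]
    rw [← Polynomial.map_mul]
    exact ((Au.charpoly_monic.mul As.charpoly_monic).map _).ne_zero
  rw [linEntropy, heig, Multiset.filter_add, Multiset.filter_eq_self.2 hu,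
    Multiset.filter_eq_nil.2 (fun z hz => not_le.2 (hs z hz)), add_zero,
    abs_det_eq_prod_norm_eigenvalues]
  generalize eigenvalues Au = s at hu
  clear heig
  induction s using Multiset.induction_on with
  | empty => simp
  | cons z s ih =>
    have hz := hu z (by simp)
    have hs' : ∀ w ∈ s, 1 ≤ ‖w‖ := fun w hw => hu w (by simp [hw])
    rw [Multiset.map_cons, Multiset.sum_cons, Multiset.map_cons, Multiset.prod_cons,
      Real.logb_mul, ih hs']
    · positivity
    · refine Multiset.prod_ne_zero fun h0 => ?_
      obtain ⟨w, hw, hw0⟩ := Multiset.mem_map.1 h0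
      linarith [hs' w hw]

/-! ### Nets, separated sets and volume -/

open MeasureTheory

/-- A compact set has a finite `δ`-separated `δ`-net. -/
theorem exists_separated_net {E : Type*} [MetricSpace E] {K : Set E} (hK : IsCompact K) {δ : ℝ}
    (hδ : 0 < δ) :
    ∃ T : Finset E, (∀ x ∈ T, x ∈ K) ∧ (∀ x ∈ T, ∀ y ∈ T, x ≠ y → δ < dist x y) ∧
      ∀ x ∈ K, ∃ y ∈ T, dist x y ≤ δ := by
  lift δ to NNReal using hδ.le
  have hpack : Metric.packingNumber δ K ≠ ⊤ := by
    -- A packing at scale `δ` is no larger than a cover at scale `δ / 2`, which is finite by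
    -- compactness.
    have h2 : δ = 2 * (δ / 2) := by rw [mul_div_cancel₀ _ two_ne_zero]
    obtain ⟨N, hNK, hNf, hN⟩ := Metric.exists_finite_isCover_of_isCompact (ε := δ / 2)
      (by simpa using hδ.ne') hK
    rw [h2]
    refine ne_top_of_le_ne_top ?_
      ((Metric.packingNumber_two_mul_le_externalCoveringNumber (δ / 2) K).trans
        hN.externalCoveringNumber_le_encard)
    simpa using hNf
  have hfin : (Metric.maximalSeparatedSet δ K).Finite := by
    rw [← Set.encard_ne_top_iff, Metric.encard_maximalSeparatedSet hpack]
    exact hpack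
  refine ⟨hfin.toFinset, fun x hx => ?_, fun x hx y hy hxy => ?_, fun x hx => ?_⟩
  · exact Metric.maximalSeparatedSet_subset (hfin.mem_toFinset.1 hx)
  · have h : (δ : ENNReal) < edist x y := Metric.isSeparated_maximalSeparatedSet (ε := δ) (A := K)
      (hfin.mem_toFinset.1 hx) (hfin.mem_toFinset.1 hy) hxy
    rw [edist_nndist, ENNReal.coe_lt_coe] at h
    exact_mod_cast h
  · have h := Metric.isCover_iff_subset_iUnion_closedBall.1
      (Metric.isCover_maximalSeparatedSet hpack) hx
    simp only [Set.mem_iUnion, Metric.mem_closedBall] at h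
    obtain ⟨y, hy, hxy⟩ := h
    exact ⟨y, hfin.mem_toFinset.2 hy, hxy⟩

/-- The volume of the image of a ball of `ℝ ^ a` under a matrix. -/
theorem volume_image_mulVec_closedBall {a : ℕ} (B : Matrix (Fin a) (Fin a) ℝ) {r : ℝ}
    (hr : 0 ≤ r) :
    volume (B.mulVec '' Metric.closedBall 0 r) = ENNReal.ofReal (|B.det| * (2 * r) ^ a) := by
  have h := Measure.addHaar_image_linearMap volume (Matrix.toLin' B) (Metric.closedBall 0 r)
  rw [LinearMap.det_toLin', Real.volume_pi_closedBall _ hr, Fintype.card_fin,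
    ← ENNReal.ofReal_mul (abs_nonneg _)] at h
  exact h

/-- The image of the unit ball under an invertible matrix `B` has a `1/2`-net whose size is
controlled by the determinant of `B` and a bound on the inverse of `B`. -/
theorem exists_half_net_image_unit_ball {a : ℕ} (B : Matrix (Fin a) (Fin a) ℝ) {c : ℝ}
    (hB : IsUnit B.det) (hc : 0 < c) (hinv : ∀ x, ‖B⁻¹.mulVec x‖ ≤ c * ‖x‖) :
    ∃ T : Finset (Fin a → ℝ), (T.card : ℝ) ≤ |B.det| * (4 + c) ^ a ∧
      ∀ x, ‖x‖ ≤ 1 → ∃ y ∈ T, ‖B.mulVec x - y‖ ≤ 1 / 2 := by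
  have hcont : Continuous B.mulVec := (Matrix.toLin' B).continuous_of_finiteDimensional
  obtain ⟨T, hTK, hsep, hnet⟩ := exists_separated_net
    ((isCompact_closedBall (0 : Fin a → ℝ) 1).image hcont) (one_half_pos (α := ℝ))
  refine ⟨T, ?_, fun x hx => ?_⟩
  swap
  · obtain ⟨y, hy, hxy⟩ := hnet (B.mulVec x) ⟨x, by simpa using hx, rfl⟩
    exact ⟨y, hy, by rwa [← dist_eq_norm]⟩
  have hdisj : (T : Set (Fin a → ℝ)).PairwiseDisjoint fun t => Metric.ball t (1 / 4) := by
    intro x hx y hy hxy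
    refine Metric.ball_disjoint_ball ?_
    have := hsep x hx y hy hxy
    linarith
  -- Pulled back by `B⁻¹`, a displacement of `1/4` has norm at most `c / 4`. The disjoint balls
  -- therefore fit into the image of a slightly larger ball, whose volume is known.
  have hsub : (⋃ t ∈ T, Metric.ball t (1 / 4)) ⊆
      B.mulVec '' Metric.closedBall 0 (1 + c / 4) := by
    intro y hy
    simp only [Set.mem_iUnion] at hy
    obtain ⟨t, ht, hyt⟩ := hy
    obtain ⟨u, hu, rfl⟩ := hTK t ht
    refine ⟨B⁻¹.mulVec y, ?_, by simp [Matrix.mulVec_mulVec, Matrix.mul_nonsing_inv _ hB]⟩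
    have hu1 : ‖u‖ ≤ 1 := by simpa using hu
    have hyt' : ‖y - B.mulVec u‖ < 1 / 4 := by rwa [← dist_eq_norm]
    have heq : B⁻¹.mulVec y = u + B⁻¹.mulVec (y - B.mulVec u) := by
      rw [Matrix.mulVec_sub, Matrix.mulVec_mulVec, Matrix.nonsing_inv_mul _ hB]
      simp
    rw [mem_closedBall_zero_iff, heq]
    refine (norm_add_le _ _).trans ?_
    have h1 := hinv (y - B.mulVec u)
    nlinarith
  have hvol := measure_mono (μ := volume) hsub
  rw [measure_biUnion_finset hdisj (fun _ _ => measurableSet_ball),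
    volume_image_mulVec_closedBall B (by positivity)] at hvol
  simp only [Real.volume_pi_ball _ (show (0 : ℝ) < 1 / 4 by norm_num), Finset.sum_const,
    Fintype.card_fin, nsmul_eq_mul] at hvol
  rw [← ENNReal.ofReal_natCast, ← ENNReal.ofReal_mul (by positivity),
    ENNReal.ofReal_le_ofReal_iff (by positivity)] at hvol
  have h1 : (2 * (1 / 4) : ℝ) ^ a * (4 + c) ^ a = (2 * (1 + c / 4)) ^ a := by
    rw [← mul_pow]; congr 1; ring
  rw [← h1] at hvol
  have h2 : (0 : ℝ) < (2 * (1 / 4)) ^ a := by positivity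
  nlinarith

/-- A ball of `ℝ ^ a` contains many points whose images under `B` are separated. -/
theorem exists_separated_image_closedBall {a : ℕ} (B : Matrix (Fin a) (Fin a) ℝ) {l δ : ℝ}
    (hl : 0 ≤ l) (hδ : 0 < δ) :
    ∃ T : Finset (Fin a → ℝ), (∀ x ∈ T, ‖x‖ ≤ l) ∧
      (∀ x ∈ T, ∀ y ∈ T, x ≠ y → δ < ‖B.mulVec (x - y)‖) ∧
      |B.det| * (l / δ) ^ a ≤ T.card := by
  classical
  have hcont : Continuous B.mulVec := (Matrix.toLin' B).continuous_of_finiteDimensional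
  obtain ⟨T, hTK, hsep, hnet⟩ := exists_separated_net
    ((isCompact_closedBall (0 : Fin a → ℝ) l).image hcont) hδ
  choose! g hg hgB using hTK
  have hinj : Set.InjOn g T := fun x hx y hy hxy => by rw [← hgB x hx, hxy, hgB y hy]
  refine ⟨T.image g, ?_, ?_, ?_⟩
  · intro x hx
    obtain ⟨t, ht, rfl⟩ := Finset.mem_image.1 hx
    simpa using hg t ht
  · intro x hx y hy hxy
    obtain ⟨t, ht, rfl⟩ := Finset.mem_image.1 hx
    obtain ⟨s, hs, rfl⟩ := Finset.mem_image.1 hy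
    rw [Matrix.mulVec_sub, hgB t ht, hgB s hs, ← dist_eq_norm]
    exact hsep t ht s hs fun h => hxy (by rw [h])
  rw [Finset.card_image_of_injOn hinj]
  have hsub : B.mulVec '' Metric.closedBall 0 l ⊆ ⋃ t ∈ T, Metric.closedBall t δ := by
    intro y hy
    obtain ⟨t, ht, hyt⟩ := hnet y hy
    simp only [Set.mem_iUnion]
    exact ⟨t, ht, hyt⟩
  have hvol := (measure_mono (μ := volume) hsub).trans (measure_biUnion_finset_le T _)
  rw [volume_image_mulVec_closedBall B hl] at hvol
  simp only [Real.volume_pi_closedBall _ hδ.le, Finset.sum_const,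
    Fintype.card_fin, nsmul_eq_mul] at hvol
  rw [← ENNReal.ofReal_natCast, ← ENNReal.ofReal_mul (by positivity),
    ENNReal.ofReal_le_ofReal_iff (by positivity)] at hvol
  have h1 : (2 * l) ^ a = (2 * δ) ^ a * (l / δ) ^ a := by
    rw [← mul_pow]; congr 1; field_simp
  rw [h1] at hvol
  have h2 : (0 : ℝ) < (2 * δ) ^ a := by positivity
  nlinarith

/-! ### Channel responses and zero-error codes -/

namespace FiniteStateChannel

variable {X Y S : Type*}

theorem CanOutput.block {ch : FiniteStateChannel X Y S} {N : ℕ} {x : Fin N → X} {y : Fin N → Y}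
    (h : ch.CanOutput x y) (k m : ℕ) (hkm : k + m ≤ N) :
    ch.CanOutput (fun i : Fin m => x ⟨k + i, by omega⟩) (fun i : Fin m => y ⟨k + i, by omega⟩) := by
  obtain ⟨s, hs⟩ := h
  exact ⟨fun i => s ⟨k + i, by omega⟩, fun i => hs ⟨k + i, by omega⟩⟩

theorem CanOutputSeq.block {ch : FiniteStateChannel X Y S} {x : ℕ → X} {y : ℕ → Y}
    (h : ch.CanOutputSeq x y) (k m : ℕ) :
    ch.CanOutput (fun i : Fin m => x (k + i)) (fun i : Fin m => y (k + i)) := by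
  obtain ⟨s, hs⟩ := h
  exact ⟨fun i => s (k + i), fun i => hs (k + i)⟩

/-- A possible response to the first `m` inputs extends to a possible response to all inputs. -/
theorem CanOutput.exists_extension {ch : FiniteStateChannel X Y S} {m : ℕ} {x : ℕ → X}
    {y : Fin m → Y} (h : ch.CanOutput (fun i : Fin m => x i) y) :
    ∃ r : ℕ → Y, ch.CanOutputSeq x r ∧ ∀ i : Fin m, r i = y i := by
  obtain ⟨s, hs⟩ := h
  choose yo so hso using ch.range_nonempty
  -- From the final state of the block, the channel is continued by arbitrary allowed transitions.
  let σ : ℕ → S := fun k => Nat.rec (s (Fin.last m)) (fun k st => so st (x (m + k))) k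
  refine ⟨fun t => if ht : t < m then y ⟨t, ht⟩ else yo (σ (t - m)) (x t),
    ⟨fun t => if ht : t < m then s ⟨t, by omega⟩ else σ (t - m), fun t => ?_⟩, fun i => by simp⟩
  rcases lt_trichotomy (t + 1) m with ht | ht | ht
  · simp only [show t < m by omega, ht, dif_pos]
    exact hs ⟨t, by omega⟩
  · subst ht
    simp only [Nat.lt_succ_self, dif_pos, lt_irrefl, dif_neg, not_false_eq_true, Nat.sub_self]
    exact hs ⟨t, by omega⟩
  · obtain ⟨k, rfl⟩ := Nat.exists_eq_add_of_le (show m ≤ t by omega)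
    simp only [show ¬ m + k < m by omega, show ¬ m + k + 1 < m by omega, dif_neg,
      not_false_eq_true, show m + k - m = k by omega, show m + k + 1 - m = k + 1 by omega]
    exact hso (σ k) (x (m + k))

theorem exists_canOutputSeq [Nonempty S] (ch : FiniteStateChannel X Y S) (x : ℕ → X) :
    ∃ r : ℕ → Y, ch.CanOutputSeq x r := by
  obtain ⟨s⟩ := ‹Nonempty S›
  obtain ⟨r, hr, -⟩ := CanOutput.exists_extension (ch := ch) (m := 0) (x := x) (y := Fin.elim0)
    ⟨fun _ => s, fun i => i.elim0⟩
  exact ⟨r, hr⟩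

theorem one_lt_card_of_zeroErrorCapacity_pos [Fintype X] {ch : FiniteStateChannel X Y S}
    (h : 0 < ch.zeroErrorCapacity) : 1 < Fintype.card X := by
  by_contra! hc
  refine absurd h (not_lt.2 (Real.sSup_nonpos ?_))
  rintro r ⟨n, F, -, rfl⟩
  have : Real.log (Fintype.card X) = 0 := by
    interval_cases Fintype.card X <;> simp
  simp [Real.logb, this]

theorem IsZeroErrorCode.le_zeroErrorCapacity [Fintype X] {ch : FiniteStateChannel X Y S}
    (hq : 1 < Fintype.card X) {n : ℕ} {F : Finset (Fin (n + 1) → X)} (hF : ch.IsZeroErrorCode F) :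
    Real.logb (Fintype.card X) F.card / ((n : ℝ) + 1) ≤ ch.zeroErrorCapacity := by
  classical
  refine le_csSup ⟨1, ?_⟩ ⟨n, F, hF, rfl⟩
  rintro r ⟨n, F, -, rfl⟩
  have hq' : (1 : ℝ) < Fintype.card X := by exact_mod_cast hq
  rw [div_le_one (by positivity)]
  rcases F.card.eq_zero_or_pos with h0 | hpos
  · rw [h0]; simp; positivity
  rw [Real.logb_le_iff_le_rpow hq' (by exact_mod_cast hpos)]
  have h1 : F.card ≤ Fintype.card X ^ (n + 1) := by
    simpa using F.card_le_univ
  have h2 : ((n : ℝ) + 1) = ((n + 1 : ℕ) : ℝ) := by push_cast; ring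
  rw [h2, Real.rpow_natCast]
  exact_mod_cast h1

/-- Concatenating `j` words of a zero-error code encodes up to `|F| ^ j` messages. -/
theorem IsZeroErrorCode.exists_block_code {ch : FiniteStateChannel X Y S} {m : ℕ}
    {F : Finset (Fin m → X)} (hF : ch.IsZeroErrorCode F) (j : ℕ) (M : Type*) [Fintype M]
    (hM : Fintype.card M ≤ F.card ^ j) :
    ∃ w : M → Fin (j * m) → X, ∀ a b y, ch.CanOutput (w a) y → ch.CanOutput (w b) y → a = b := by
  classical
  have hcard : Fintype.card M ≤ Fintype.card (Fin j → F) := by simpa using hM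
  obtain ⟨φ⟩ := Function.Embedding.nonempty_of_card_le hcard
  refine ⟨fun a p => (φ a p.divNat : Fin m → X) p.modNat, fun a b y ha hb => ?_⟩
  by_contra hab
  obtain ⟨i, hi⟩ := Function.ne_iff.1 (φ.injective.ne hab)
  have hle : i * m + m ≤ j * m := by
    calc i * m + m = (i + 1) * m := by ring
      _ ≤ j * m := Nat.mul_le_mul_right _ i.2
  -- Block `i`, where the two messages differ, is cut out. Codes tolerate any initial state, so the
  -- state at the start of the block is irrelevant.
  have key : ∀ c : M, (fun k : Fin m => (φ c (Fin.divNat (⟨i * m + k, by omega⟩ : Fin (j * m))) :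
      Fin m → X) (Fin.modNat (⟨i * m + k, by omega⟩ : Fin (j * m)))) = (φ c i : Fin m → X) := by
    intro c
    funext k
    have hk : 0 < m := k.pos
    have h1 : Fin.divNat (⟨i * m + k, by omega⟩ : Fin (j * m)) = i := by
      ext
      simp only [Fin.coe_divNat]
      rw [add_comm, Nat.add_mul_div_right _ _ hk, Nat.div_eq_of_lt k.2, zero_add]
    have h2 : Fin.modNat (⟨i * m + k, by omega⟩ : Fin (j * m)) = k := by
      ext
      simp only [Fin.coe_modNat]
      rw [add_comm, Nat.add_mul_mod_self_right, Nat.mod_eq_of_lt k.2]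
    rw [h1, h2]
  have ha' := ha.block (i * m) m hle
  have hb' := hb.block (i * m) m hle
  rw [key] at ha' hb'
  exact hF _ (φ a i).2 _ (φ b i).2 (fun h => hi (Subtype.ext h)) _ ⟨ha', hb'⟩

end FiniteStateChannel

theorem plantState_zero_noise {nx : ℕ} (A : Matrix (Fin nx) (Fin nx) ℝ) (x₀ : Fin nx → ℝ) (t : ℕ) :
    plantState A x₀ 0 t = (A ^ t).mulVec x₀ := by
  induction t with
  | zero => simp [plantState]
  | succ t ih => simp [plantState, ih, pow_succ', Matrix.mulVec_mulVec]

/-- An invariant coordinate intertwines the powers of the matrices. -/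
theorem apply_pow_mulVec {m n : ℕ} {A : Matrix (Fin m) (Fin m) ℝ} {B : Matrix (Fin n) (Fin n) ℝ}
    {P : (Fin m → ℝ) →ₗ[ℝ] (Fin n → ℝ)} (hP : ∀ x, P (A.mulVec x) = B.mulVec (P x)) (t : ℕ)
    (x : Fin m → ℝ) : P ((A ^ t).mulVec x) = (B ^ t).mulVec (P x) := by
  induction t with
  | zero => simp
  | succ t ih => rw [pow_succ', ← Matrix.mulVec_mulVec, hP, ih, Matrix.mulVec_mulVec, ← pow_succ']

theorem exists_norm_le_mul {E F : Type*} [NormedAddCommGroup E] [NormedSpace ℝ E]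
    [FiniteDimensional ℝ E] [NormedAddCommGroup F] [NormedSpace ℝ F] (P : E →ₗ[ℝ] F) :
    ∃ c : ℝ, 0 < c ∧ ∀ x, ‖P x‖ ≤ c * ‖x‖ :=
  (LinearMap.toContinuousLinearMap P).bound

/-! ### Necessity: separated trajectories give zero-error codes -/

section Necessity

variable {nx ny : ℕ} {X Y S : Type*}

/-- Initial conditions which separate by time `t + 1` by more than twice the error bound are
encoded into channel inputs that form a zero-error code. -/
theorem exists_zeroErrorCode_of_separated [Nonempty S] {K : CoderEstimator nx ny X Y}
    {A : Matrix (Fin nx) (Fin nx) ℝ} {C : Matrix (Fin ny) (Fin nx) ℝ}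
    {ch : FiniteStateChannel X Y S} {β : ℝ} {t : ℕ} {T : Finset (Fin nx → ℝ)}
    (hK : ∀ x₀ ∈ T, ∀ r : ℕ → Y, ch.CanOutputSeq (K.input (plantOutput A C x₀ 0 0)) r →
      ‖K.estimate r (t + 1) - plantState A x₀ 0 (t + 1)‖ ≤ β)
    (hT : ∀ x ∈ T, ∀ x' ∈ T, x ≠ x' → 2 * β < ‖(A ^ (t + 1)).mulVec (x - x')‖) :
    ∃ F : Finset (Fin (t + 1) → X), ch.IsZeroErrorCode F ∧ F.card = T.card := by
  classical
  let D : (Fin nx → ℝ) → Fin (t + 1) → X := fun x₀ i => K.input (plantOutput A C x₀ 0 0) i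
  have key : ∀ x ∈ T, ∀ x' ∈ T, ∀ y : Fin (t + 1) → Y,
      ch.CanOutput (D x) y → ch.CanOutput (D x') y → x = x' := by
    intro x hx x' hx' y hy hy'
    obtain ⟨r, hr, hry⟩ := hy.exists_extension
    obtain ⟨r', hr', hry'⟩ := hy'.exists_extension
    by_contra hne
    have h1 := hK x hx r hr
    have h2 := hK x' hx' r' hr'
    -- The estimate at time `t + 1` uses only outputs up to time `t`, which agree; one estimate
    -- cannot be within `β` of both states.
    have heq : K.estimate r (t + 1) = K.estimate r' (t + 1) := by
      simp only [CoderEstimator.estimate, hry, hry']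
    rw [plantState_zero_noise] at h1 h2
    have h3 := hT x hx x' hx' hne
    rw [Matrix.mulVec_sub] at h3
    rw [heq, norm_sub_rev] at h1
    have h4 := norm_sub_le_norm_sub_add_norm_sub ((A ^ (t + 1)).mulVec x)
      (K.estimate r' (t + 1)) ((A ^ (t + 1)).mulVec x')
    linarith
  have hinj : Set.InjOn D T := by
    intro x hx x' hx' hxx'
    -- Equal inputs share a possible output, so injectivity follows from `key`.
    obtain ⟨r, hr⟩ := ch.exists_canOutputSeq (K.input (plantOutput A C x 0 0))
    have hb : ch.CanOutput (D x) fun i => r i := by simpa [D] using hr.block 0 (t + 1)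
    exact key x hx x' hx' _ hb (hxx' ▸ hb)
  refine ⟨T.image D, ?_, Finset.card_image_of_injOn hinj⟩
  intro w hw w' hw' hne y hy
  obtain ⟨x, hx, rfl⟩ := Finset.mem_image.1 hw
  obtain ⟨x', hx', rfl⟩ := Finset.mem_image.1 hw'
  exact hne (by rw [key x hx x' hx' y hy.1 hy.2])

theorem linEntropy_le_zeroErrorCapacity [Fintype X] [Nonempty S] {A : Matrix (Fin nx) (Fin nx) ℝ}
    {C : Matrix (Fin ny) (Fin nx) ℝ} {ch : FiniteStateChannel X Y S}
    (hC₀ : 0 < ch.zeroErrorCapacity) {K : CoderEstimator nx ny X Y}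
    (hK : K.UniformlyBoundedErrors A C ch) :
    linEntropy (Fintype.card X) A ≤ ch.zeroErrorCapacity := by
  classical
  have hq := FiniteStateChannel.one_lt_card_of_zeroErrorCapacity_pos hC₀
  have hq' : (1 : ℝ) < Fintype.card X := by exact_mod_cast hq
  obtain ⟨a, b, Au, As, L, hL, hch, hu, hs⟩ := exists_unstable_stable_decomposition A
  have hdet := one_le_abs_det hu
  rw [linEntropy_eq_logb_det hch hu hs]
  have hz : ∀ k : ℕ, IsAdmissibleNoise ({0} : Set (ℕ → Fin k → ℝ)) := fun k =>
    ⟨⟨0, by simp⟩, rfl⟩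
  obtain ⟨l, hl, hbound⟩ := hK {0} {0} (hz nx) (hz ny)
  obtain ⟨β, hβ⟩ := hbound _ subset_rfl
  let P : (Fin nx → ℝ) →ₗ[ℝ] (Fin a → ℝ) := LinearMap.fst ℝ _ _ ∘ₗ L.toLinearMap
  let J : (Fin a → ℝ) →ₗ[ℝ] (Fin nx → ℝ) := L.symm.toLinearMap ∘ₗ LinearMap.inl ℝ _ _
  have hPJ : ∀ u, P (J u) = u := fun u => by simp [P, J]
  have hP : ∀ x, P (A.mulVec x) = Au.mulVec (P x) := fun x => by simp [P, hL]
  obtain ⟨cP, hcP, hPb⟩ := exists_norm_le_mul P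
  obtain ⟨cJ, hcJ, hJb⟩ := exists_norm_le_mul J
  -- Separation `δ` of the unstable coordinates forces states more than `2 * β` apart, since `P`
  -- expands norms by at most `cP`.
  set δ : ℝ := cP * (2 * |β|) + 1 with hδdef
  have hδ : 0 < δ := by positivity
  obtain ⟨κ, hκdef⟩ : ∃ κ : ℝ, κ = (l / cJ / δ) ^ a := ⟨_, rfl⟩
  have hκ : 0 < κ := by rw [hκdef]; positivity
  have hcode : ∀ n : ℕ,
      Real.logb (Fintype.card X) κ / ((n : ℝ) + 1) + Real.logb (Fintype.card X) |Au.det| ≤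
        ch.zeroErrorCapacity := by
    intro n
    obtain ⟨T, hTl, hTsep, hTcard⟩ := exists_separated_image_closedBall (Au ^ (n + 1))
      (l := l / cJ) (δ := δ) (by positivity) hδ
    have hJinj : Function.Injective J := Function.LeftInverse.injective hPJ
    obtain ⟨F, hF, hFcard⟩ := exists_zeroErrorCode_of_separated (K := K) (A := A) (C := C)
      (ch := ch) (β := β) (t := n) (T := T.image J) (by
        intro x₀ hx₀ r hr
        obtain ⟨u, hu, rfl⟩ := Finset.mem_image.1 hx₀
        refine hβ _ ?_ 0 rfl 0 rfl r hr (n + 1)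
        rw [mem_closedBall_zero_iff]
        refine (hJb u).trans ?_
        calc cJ * ‖u‖ ≤ cJ * (l / cJ) := by gcongr; exact hTl u hu
          _ = l := by field_simp) (by
        intro x hx x' hx' hne
        obtain ⟨u, hu, rfl⟩ := Finset.mem_image.1 hx
        obtain ⟨u', hu', rfl⟩ := Finset.mem_image.1 hx'
        have h1 := hTsep u hu u' hu' fun h => hne (by rw [h])
        rw [← map_sub]
        have h2 := hPb ((A ^ (n + 1)).mulVec (J (u - u')))
        rw [apply_pow_mulVec hP, hPJ] at h2
        by_contra! hc
        have h3 : cP * ‖(A ^ (n + 1)).mulVec (J (u - u'))‖ ≤ cP * (2 * |β|) := by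
          gcongr
          exact hc.trans (by gcongr; exact le_abs_self β)
        linarith)
    rw [Finset.card_image_of_injective _ hJinj] at hFcard
    refine le_trans ?_ (hF.le_zeroErrorCapacity hq)
    rw [hFcard, le_div_iff₀ (by positivity)]
    have h1 : κ * |Au.det| ^ (n + 1) ≤ T.card := by
      rw [Matrix.det_pow, abs_pow, mul_comm] at hTcard
      rwa [hκdef]
    have h2 : 0 < |Au.det| ^ (n + 1) := by positivity
    refine le_trans (le_of_eq ?_) (Real.logb_le_logb_of_le hq' (by positivity) h1)
    rw [Real.logb_mul hκ.ne' h2.ne', Real.logb_pow]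
    push_cast
    field_simp
  have hlim : Filter.Tendsto (fun n : ℕ => Real.logb (Fintype.card X) κ / ((n : ℝ) + 1) +
      Real.logb (Fintype.card X) |Au.det|) Filter.atTop
      (nhds (0 + Real.logb (Fintype.card X) |Au.det|)) := by
    refine Filter.Tendsto.add_const _ ?_
    exact tendsto_const_nhds.div_atTop
      (Filter.tendsto_atTop_add_const_right _ _ tendsto_natCast_atTop_atTop)
  rw [zero_add] at hlim
  exact le_of_tendsto' hlim hcode

end Necessity

theorem norm_pow_mulVec_le {n : ℕ} {A : Matrix (Fin n) (Fin n) ℝ} {M : ℝ} (hM : 0 ≤ M)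
    (hA : ∀ x, ‖A.mulVec x‖ ≤ M * ‖x‖) (k : ℕ) (x : Fin n → ℝ) :
    ‖(A ^ k).mulVec x‖ ≤ M ^ k * ‖x‖ := by
  induction k with
  | zero => simp
  | succ k ih =>
    rw [pow_succ', ← Matrix.mulVec_mulVec]
    refine (hA _).trans ?_
    calc M * ‖(A ^ k).mulVec x‖ ≤ M * (M ^ k * ‖x‖) := by gcongr
      _ = M ^ (k + 1) * ‖x‖ := by ring

theorem exists_one_le_norm_mulVec_le {n : ℕ} (A : Matrix (Fin n) (Fin n) ℝ) :
    ∃ M : ℝ, 1 ≤ M ∧ ∀ x, ‖A.mulVec x‖ ≤ M * ‖x‖ := by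
  obtain ⟨c, -, h⟩ := exists_norm_le_mul (Matrix.toLin' A)
  refine ⟨max 1 c, le_max_left _ _, fun x => (h x).trans ?_⟩
  gcongr
  exact le_max_right _ _

section Quantizer

/-! ### Covering the image of a ball under powers of the unstable part -/

/-- Nonzero eigenvalues of the inverse are reciprocals of eigenvalues. This yields the bound `c * θ
^ n` on inverse powers for every `θ > 1`. -/
theorem norm_le_one_of_mem_eigenvalues_inv {n : ℕ} {M : Matrix (Fin n) (Fin n) ℝ}
    (h : ∀ z ∈ eigenvalues M, 1 ≤ ‖z‖) {z : ℂ} (hz : z ∈ eigenvalues M⁻¹) : ‖z‖ ≤ 1 := by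
  rcases eq_or_ne z 0 with rfl | hz0
  · simp
  have hdet : IsUnit M := by
    rw [Matrix.isUnit_iff_isUnit_det, isUnit_iff_ne_zero, ← abs_pos]
    linarith [one_le_abs_det h]
  obtain ⟨U, rfl⟩ := hdet
  let Uc := Units.map ((algebraMap ℝ ℂ).mapMatrix : Matrix (Fin n) (Fin n) ℝ →+* _).toMonoidHom U
  have hz' : ((Units.mk0 z hz0 : ℂˣ) : ℂ) ∈
      spectrum ℂ ((Uc⁻¹ : (Matrix (Fin n) (Fin n) ℂ)ˣ) : Matrix (Fin n) (Fin n) ℂ) := by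
    rw [mem_eigenvalues_iff, ← Matrix.coe_units_inv] at hz
    exact hz
  have h2 := spectrum.inv_mem_iff.1 hz'
  have h3 := h _ ((mem_eigenvalues_iff _ _).2 h2)
  rw [Units.val_inv_eq_inv_val, Units.val_mk0, norm_inv] at h3
  exact (one_le_inv₀ (norm_pos_iff.2 hz0)).1 h3

/-- If `g` exceeds the volume growth of `M` over `m` steps, then for a suitable number `j` of
repetitions, the image of the unit ball under `M ^ (j * m)` has a `1/2`-net with fewer than
`g ^ j` points. -/
theorem exists_half_net_pow {a : ℕ} {M : Matrix (Fin a) (Fin a) ℝ}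
    (hM : ∀ z ∈ eigenvalues M, 1 ≤ ‖z‖) {m g : ℕ} (hg : |M.det| ^ m < g) :
    ∃ (j : ℕ) (T : Finset (Fin a → ℝ)), 0 < j ∧ T.card + 1 ≤ g ^ j ∧
      ∀ x, ‖x‖ ≤ 1 → ∃ y ∈ T, ‖(M ^ (j * m)).mulVec x - y‖ ≤ 1 / 2 := by
  have hdet := one_le_abs_det hM
  set Δ := |M.det| with hΔ
  have hΔm : 0 < Δ ^ m := by positivity
  have hγ : 1 < (g : ℝ) / Δ ^ m := by rwa [one_lt_div hΔm]
  -- The growth rate `θ` of the inverse powers enters the net size with exponent `m * a` per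
  -- repetition; it is taken close enough to one to stay within the surplus of `g` over `Δ ^ m`.
  obtain ⟨θ, hθ1, hθ⟩ : ∃ θ : ℝ, 1 < θ ∧ θ ^ (m * a) < g / Δ ^ m := by
    have hc : Filter.Tendsto (fun θ : ℝ => θ ^ (m * a)) (nhdsWithin 1 (Set.Ioi 1)) (nhds 1) := by
      have := ((continuous_pow (m * a)).tendsto (1 : ℝ)).mono_left
        (nhdsWithin_le_nhds (s := Set.Ioi 1))
      simpa using this
    have h1 := hc.eventually (gt_mem_nhds hγ)
    obtain ⟨θ, h2, h3⟩ := (h1.and self_mem_nhdsWithin).exists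
    exact ⟨θ, h3, h2⟩
  obtain ⟨c, hc, hcb⟩ := exists_norm_pow_mulVec_le M⁻¹ (zero_lt_one.trans hθ1)
    fun z hz => (norm_le_one_of_mem_eigenvalues_inv hM hz).trans_lt hθ1
  have hθp : 0 < θ ^ (m * a) := by positivity
  have hratio : 1 < g / Δ ^ m / θ ^ (m * a) := by rwa [one_lt_div hθp]
  -- Enough repetitions beat the constant of the volume count; the `+ 1` pays for the overflow
  -- message.
  obtain ⟨j, hj⟩ := pow_unbounded_of_one_lt ((4 + c) ^ a + 1) hratio
  have hj0 : 0 < j := by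
    rcases j.eq_zero_or_pos with rfl | h
    · have : 0 < (4 + c) ^ a := by positivity
      rw [pow_zero] at hj
      linarith
    · exact h
  have hunit : IsUnit (M ^ (j * m)).det := by
    rw [isUnit_iff_ne_zero, Matrix.det_pow]
    refine pow_ne_zero _ (abs_pos.1 ?_)
    linarith
  have hθn : 1 ≤ θ ^ (j * m) := one_le_pow₀ hθ1.le
  obtain ⟨T, hT, hnet⟩ := exists_half_net_image_unit_ball (M ^ (j * m)) (c := c * θ ^ (j * m))
    hunit (by positivity) (fun x => by rw [← Matrix.inv_pow']; exact hcb _ x)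
  refine ⟨j, T, hj0, ?_, hnet⟩
  have h1 : (T.card : ℝ) + 1 ≤ (g : ℝ) ^ j := by
    have hΔj : 1 ≤ Δ ^ (j * m) := one_le_pow₀ hdet
    have hθj : 1 ≤ (θ ^ (j * m)) ^ a := one_le_pow₀ hθn
    rw [Matrix.det_pow, abs_pow, ← hΔ] at hT
    calc (T.card : ℝ) + 1 ≤ Δ ^ (j * m) * (4 + c * θ ^ (j * m)) ^ a + 1 := by linarith
      _ ≤ Δ ^ (j * m) * ((4 + c) * θ ^ (j * m)) ^ a + Δ ^ (j * m) * (θ ^ (j * m)) ^ a := by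
        gcongr
        · nlinarith
        · exact one_le_mul_of_one_le_of_one_le hΔj hθj
      _ = ((4 + c) ^ a + 1) * (Δ ^ (j * m) * (θ ^ (j * m)) ^ a) := by rw [mul_pow]; ring
      _ ≤ (g / Δ ^ m / θ ^ (m * a)) ^ j * (Δ ^ (j * m) * (θ ^ (j * m)) ^ a) := by gcongr
      _ = (g : ℝ) ^ j := by
        rw [div_pow, div_pow, ← pow_mul, ← pow_mul, ← pow_mul, mul_comm m j,
          show m * a * j = j * m * a by ring]
        field_simp
  exact_mod_cast h1

/-! ### An adaptive quantizer

The state `(z, N)` of the quantizer consists of the current estimate `z` and the number `N` of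
overflows so far; its range is `H ^ N`. -/

variable {E : Type*} [NormedAddCommGroup E] [NormedSpace ℝ E]

/-- The state update of the quantizer upon a message: a net point, or `none` on overflow. -/
def quantizerStep (B : E →ₗ[ℝ] E) (H : ℝ) {T : Finset E} (σ : E × ℕ) : Option T → E × ℕ
  | some c => (B σ.1 + H ^ σ.2 • (c : E), σ.2)
  | none => (B σ.1, σ.2 + 1)

/-- The quantizer state after `k` messages. -/
def quantizerState (B : E →ₗ[ℝ] E) (H : ℝ) {T : Finset E} (μ : ℕ → Option T) : ℕ → E × ℕ
  | 0 => (0, 0)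
  | k + 1 => quantizerStep B H (quantizerState B H μ k) (μ k)

open Classical in
/-- The message that the quantizer in state `σ` produces for the vector `x`. -/
noncomputable def quantizerEncode (B : E →ₗ[ℝ] E) (H : ℝ) (T : Finset E) (σ : E × ℕ) (x : E) :
    Option T :=
  if h : ∃ c : T, ‖B (x - σ.1) - H ^ σ.2 • (c : E)‖ ≤ H ^ σ.2 / 2 then some h.choose else none

/-- The quantizer state after processing `x 0, …, x (k - 1)`. -/
noncomputable def quantizerRun (B : E →ₗ[ℝ] E) (H : ℝ) (T : Finset E) (x : ℕ → E) : ℕ → E × ℕ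
  | 0 => (0, 0)
  | k + 1 => quantizerStep B H (quantizerRun B H T x k)
      (quantizerEncode B H T (quantizerRun B H T x k) (x k))

/-- The message produced for `x k`. -/
noncomputable def quantizerMessage (B : E →ₗ[ℝ] E) (H : ℝ) (T : Finset E) (x : ℕ → E) (k : ℕ) :
    Option T :=
  quantizerEncode B H T (quantizerRun B H T x k) (x k)

theorem quantizerState_message (B : E →ₗ[ℝ] E) (H : ℝ) (T : Finset E) (x : ℕ → E) (k : ℕ) :
    quantizerState B H (quantizerMessage B H T x) k = quantizerRun B H T x k := by
  induction k with
  | zero => rfl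
  | succ k ih => rw [quantizerState, ih, quantizerRun, quantizerMessage]

theorem quantizerState_congr (B : E →ₗ[ℝ] E) (H : ℝ) {T : Finset E} {μ μ' : ℕ → Option T} {k : ℕ}
    (h : ∀ i < k, μ i = μ' i) : quantizerState B H μ k = quantizerState B H μ' k := by
  induction k with
  | zero => rfl
  | succ k ih =>
    rw [quantizerState, quantizerState, ih fun i hi => h i (by omega), h k (by omega)]

theorem quantizerRun_congr (B : E →ₗ[ℝ] E) (H : ℝ) (T : Finset E) {x x' : ℕ → E} {k : ℕ}
    (h : ∀ i < k, x i = x' i) : quantizerRun B H T x k = quantizerRun B H T x' k := by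
  induction k with
  | zero => rfl
  | succ k ih =>
    rw [quantizerRun, quantizerRun, ih fun i hi => h i (by omega), h k (by omega)]

theorem quantizerMessage_congr (B : E →ₗ[ℝ] E) (H : ℝ) (T : Finset E) {x x' : ℕ → E} {k : ℕ}
    (h : ∀ i ≤ k, x i = x' i) : quantizerMessage B H T x k = quantizerMessage B H T x' k := by
  rw [quantizerMessage, quantizerMessage, quantizerRun_congr B H T fun i hi => h i hi.le,
    h k le_rfl]

theorem quantizerEncode_eq_some {B : E →ₗ[ℝ] E} {H : ℝ} {T : Finset E} {σ : E × ℕ} {x : E} {c : T}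
    (h : quantizerEncode B H T σ x = some c) :
    ‖B (x - σ.1) - H ^ σ.2 • (c : E)‖ ≤ H ^ σ.2 / 2 := by
  rw [quantizerEncode] at h
  split_ifs at h with hc
  rw [← Option.some.inj h]
  exact hc.choose_spec

/-- Rescaling by the range reduces to the unit ball, so an overflow certifies that the error exceeds
the range. -/
theorem quantizerEncode_eq_none {B : E →ₗ[ℝ] E} {H : ℝ} (hH : 0 < H) {T : Finset E}
    (hT : ∀ x, ‖x‖ ≤ 1 → ∃ y ∈ T, ‖B x - y‖ ≤ 1 / 2) {σ : E × ℕ} {x : E}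
    (h : quantizerEncode B H T σ x = none) : H ^ σ.2 < ‖x - σ.1‖ := by
  rw [quantizerEncode] at h
  split_ifs at h with hc
  by_contra! hle
  have hp : 0 < H ^ σ.2 := by positivity
  obtain ⟨y, hy, hyb⟩ := hT ((H ^ σ.2)⁻¹ • (x - σ.1)) (by
    rw [norm_smul, norm_inv, Real.norm_of_nonneg hp.le, inv_mul_le_one₀ hp]
    exact hle)
  refine hc ⟨⟨y, hy⟩, ?_⟩
  have heq : B (x - σ.1) - H ^ σ.2 • y = H ^ σ.2 • (B ((H ^ σ.2)⁻¹ • (x - σ.1)) - y) := by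
    rw [map_smul, smul_sub, smul_inv_smul₀ hp.ne']
  rw [heq, norm_smul, Real.norm_of_nonneg hp.le]
  calc H ^ σ.2 * ‖B ((H ^ σ.2)⁻¹ • (x - σ.1)) - y‖ ≤ H ^ σ.2 * (1 / 2) := by gcongr
    _ = H ^ σ.2 / 2 := by ring

/-- The adaptive quantizer tracks `x (k + 1) = B (x k) + O(1)` with bounded error, although its
definition does not involve the bound on the perturbation. -/
theorem quantizerRun_bounded {B : E →ₗ[ℝ] E} {M : ℝ} (hM : 1 ≤ M) (hB : ∀ x, ‖B x‖ ≤ M * ‖x‖)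
    {T : Finset E} (hT : ∀ x, ‖x‖ ≤ 1 → ∃ y ∈ T, ‖B x - y‖ ≤ 1 / 2) (b : ℝ) :
    ∃ β : ℝ, ∀ x : ℕ → E, ‖x 0‖ ≤ b → (∀ k, ‖x (k + 1) - B (x k)‖ ≤ b) →
      ∀ k, ‖x k - (quantizerRun B (4 * M) T x k).1‖ ≤ β := by
  obtain ⟨n, hn⟩ := pow_unbounded_of_one_lt (max b 1) (one_lt_two (α := ℝ))
  set K := max b 1 with hK
  have hK1 : 1 ≤ K := le_max_right _ _
  set H := 4 * M with hH
  have hH0 : 0 < H := by positivity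
  refine ⟨H ^ (n + 1) + K * (2 * M) ^ (n + 1), fun x hx0 hx k => ?_⟩
  -- As `H ^ N = 2 ^ N * (2 * M) ^ N` and `2 ^ n > K`, the range dominates the excess `K * (2 * M) ^
  -- N` from `N = n` on. After overflow `n + 1` the error is within the range, and no further
  -- overflow can occur.
  suffices key : ‖x k - (quantizerRun B H T x k).1‖ ≤
        H ^ (quantizerRun B H T x k).2 + K * (2 * M) ^ (quantizerRun B H T x k).2 ∧
      (quantizerRun B H T x k).2 ≤ n + 1 ∧ ((quantizerRun B H T x k).2 = n + 1 →
        ‖x k - (quantizerRun B H T x k).1‖ ≤ H ^ (quantizerRun B H T x k).2) by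
    refine key.1.trans ?_
    have h2 := key.2.1
    have h3 : 1 ≤ H := by linarith
    have h4 : 1 ≤ 2 * M := by linarith
    gcongr
  induction k with
  | zero =>
    have h1 : ‖x 0‖ ≤ K := hx0.trans (le_max_left _ _)
    simp only [quantizerRun]
    refine ⟨by simp; linarith, by omega, fun h => by omega⟩
  | succ k ih =>
    obtain ⟨ih1, ih2, ih3⟩ := ih
    rw [quantizerRun]
    generalize quantizerRun B H T x k = σ at *
    obtain ⟨z, N⟩ := σ
    simp only at ih1 ih2 ih3
    have hpow : (2 : ℝ) ^ N * (2 * M) ^ N = H ^ N := by rw [← mul_pow]; congr 1; rw [hH]; ring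
    have hHN : 0 < H ^ N := by positivity
    have hMN : 1 ≤ (2 * M) ^ N := one_le_pow₀ (by linarith)
    have hxk : ‖x (k + 1) - B (x k)‖ ≤ K := (hx k).trans (le_max_left _ _)
    cases hq : quantizerEncode B H T (z, N) (x k) with
    | some c =>
      have hc := quantizerEncode_eq_some hq
      simp only [quantizerStep] at hc ⊢
      have hstep : ‖x (k + 1) - (B z + H ^ N • (c : E))‖ ≤ K + H ^ N / 2 := by
        have : x (k + 1) - (B z + H ^ N • (c : E)) =
            (x (k + 1) - B (x k)) + (B (x k - z) - H ^ N • (c : E)) := by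
          rw [map_sub]; abel
        rw [this]
        exact (norm_add_le _ _).trans (add_le_add hxk hc)
      refine ⟨by nlinarith, ih2, fun hN => hstep.trans ?_⟩
      have h1 : (2 : ℝ) ^ (n + 1) ≤ H ^ N := by
        rw [hN]
        gcongr
        linarith
      rw [pow_succ] at h1
      linarith
    | none =>
      have hc := quantizerEncode_eq_none hH0 hT hq
      simp only [quantizerStep] at hc ⊢
      have hNn : N ≤ n := by
        by_contra hcon
        have : N = n + 1 := by omega
        linarith [ih3 this]
      have hstep : ‖x (k + 1) - B z‖ ≤ K + M * (H ^ N + K * (2 * M) ^ N) := by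
        have : x (k + 1) - B z = (x (k + 1) - B (x k)) + B (x k - z) := by
          rw [map_sub]; abel
        rw [this]
        refine (norm_add_le _ _).trans (add_le_add hxk ((hB _).trans ?_))
        gcongr
      refine ⟨hstep.trans ?_, by omega, fun hN => hstep.trans ?_⟩
      · rw [pow_succ, pow_succ, hH, ← hH]
        have h1 : K ≤ K * M * (2 * M) ^ N := by
          rw [mul_assoc]
          exact le_mul_of_one_le_right (by linarith) (one_le_mul_of_one_le_of_one_le hM hMN)
        have h2 : 0 < M * H ^ N := by positivity
        nlinarith
      -- Here the new error is at most `K + 2 * M * H ^ n`, hence at most `3 * M * H ^ n`, below the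
      -- new range `4 * M * H ^ n`.
      · have hNeq : N = n := by omega
        subst hNeq
        have h1 : K * (2 * M) ^ N ≤ H ^ N := by
          rw [← hpow]; gcongr
        have h2 : K ≤ H ^ N := (le_mul_of_one_le_right (by linarith) hMN).trans h1
        have h3 : M * (H ^ N + K * (2 * M) ^ N) ≤ M * (H ^ N + H ^ N) := by gcongr
        have h4 : H ^ N ≤ M * H ^ N := le_mul_of_one_le_left hHN.le hM
        have h5 : H ^ (N + 1) = 4 * (M * H ^ N) := by rw [pow_succ, hH]; ring
        rw [h5]
        linarith

end Quantizer

variable {nx ny : ℕ}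

/-! ### State reconstruction and the stable part -/

section Plant

theorem norm_plantState_add_sub_le {A : Matrix (Fin nx) (Fin nx) ℝ} {M : ℝ} (hM : 1 ≤ M)
    (hA : ∀ x, ‖A.mulVec x‖ ≤ M * ‖x‖) {x₀ : Fin nx → ℝ} {v : ℕ → Fin nx → ℝ} {b : ℝ}
    (hb : 0 ≤ b) (hv : ∀ t, ‖v t‖ ≤ b) (s k : ℕ) :
    ‖plantState A x₀ v (s + k) - (A ^ k).mulVec (plantState A x₀ v s)‖ ≤ b * k * M ^ k := by
  induction k with
  | zero => simp
  | succ k ih =>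
    have h1 : plantState A x₀ v (s + (k + 1)) - (A ^ (k + 1)).mulVec (plantState A x₀ v s) =
        A.mulVec (plantState A x₀ v (s + k) - (A ^ k).mulVec (plantState A x₀ v s)) +
          v (s + k) := by
      rw [← add_assoc, plantState, Matrix.mulVec_sub, Matrix.mulVec_mulVec, pow_succ']
      abel
    rw [h1]
    refine (norm_add_le _ _).trans ?_
    have h2 := (hA _).trans (mul_le_mul_of_nonneg_left ih (by linarith))
    have h3 : b ≤ b * M ^ (k + 1) := le_mul_of_one_le_right hb (one_le_pow₀ hM)
    calc _ ≤ M * (b * k * M ^ k) + b := add_le_add h2 (hv _)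
      _ ≤ M * (b * k * M ^ k) + b * M ^ (k + 1) := by gcongr
      _ = b * ((k + 1 : ℕ) : ℝ) * M ^ (k + 1) := by push_cast; ring

/-- An observable pair admits a linear reconstruction of the state from finitely many outputs. -/
theorem IsObservable.exists_reconstruction {C : Matrix (Fin ny) (Fin nx) ℝ}
    {A : Matrix (Fin nx) (Fin nx) ℝ} (h : IsObservable C A) :
    ∃ (N : ℕ) (G : (Fin N → Fin ny → ℝ) →ₗ[ℝ] (Fin nx → ℝ)),
      ∀ x, G (fun k => C.mulVec ((A ^ (k : ℕ)).mulVec x)) = x := by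
  let O : (N : ℕ) → (Fin nx → ℝ) →ₗ[ℝ] (Fin N → Fin ny → ℝ) := fun N =>
    LinearMap.pi fun k => Matrix.toLin' C ∘ₗ Matrix.toLin' (A ^ (k : ℕ))
  have hker : ∀ N x, x ∈ LinearMap.ker (O N) ↔ ∀ k < N, C.mulVec ((A ^ k).mulVec x) = 0 := by
    intro N x
    rw [LinearMap.mem_ker, funext_iff]
    exact ⟨fun hx k hk => hx ⟨k, hk⟩, fun hx k => hx k k.2⟩
  have hanti : ∀ {N N' : ℕ}, N ≤ N' → LinearMap.ker (O N') ≤ LinearMap.ker (O N) := by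
    intro N N' hNN' x hx
    rw [hker] at hx ⊢
    exact fun k hk => hx k (hk.trans_le hNN')
  -- The decreasing kernels of the truncated observability maps stabilise, and injectivity of the
  -- infinite map makes the limit zero.
  obtain ⟨N, hN⟩ := IsArtinian.monotone_stabilizes
    (⟨fun N => OrderDual.toDual (LinearMap.ker (O N)), fun _ _ h => hanti h⟩ :
      ℕ →o (Submodule ℝ (Fin nx → ℝ))ᵒᵈ)
  have hbot : LinearMap.ker (O N) = ⊥ := by
    rw [eq_bot_iff]
    intro x hx
    rw [Submodule.mem_bot]
    refine h (funext fun k => ?_)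
    have h1 : LinearMap.ker (O N) = LinearMap.ker (O (max N (k + 1))) := hN _ (le_max_left _ _)
    rw [h1, hker] at hx
    simp [hx k (lt_max_of_lt_right (Nat.lt_succ_self k))]
  obtain ⟨G, hG⟩ := (O N).exists_leftInverse_of_injective hbot
  exact ⟨N, G, fun x => LinearMap.congr_fun hG x⟩

/-- The state reconstructed at time `t` from the last `N` outputs before time `t`. -/
def observer (A : Matrix (Fin nx) (Fin nx) ℝ) {N : ℕ}
    (G : (Fin N → Fin ny → ℝ) →ₗ[ℝ] (Fin nx → ℝ)) (y : ℕ → Fin ny → ℝ) (t : ℕ) : Fin nx → ℝ :=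
  if N ≤ t then (A ^ N).mulVec (G fun k => y (t - N + k)) else 0

theorem observer_congr (A : Matrix (Fin nx) (Fin nx) ℝ) {N : ℕ}
    (G : (Fin N → Fin ny → ℝ) →ₗ[ℝ] (Fin nx → ℝ)) {y y' : ℕ → Fin ny → ℝ} {t : ℕ}
    (h : ∀ i < t, y i = y' i) : observer A G y t = observer A G y' t := by
  rw [observer, observer]
  split_ifs with hN
  · congr 2
    funext k
    exact h _ (by omega)
  · rfl

/-- Noise perturbs a window of `N` outputs by a bounded amount, which `G` and `A ^ N` amplify by
fixed factors. Before time `N` the observer is zero and the state is still bounded. -/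
theorem observer_bounded (A : Matrix (Fin nx) (Fin nx) ℝ) (C : Matrix (Fin ny) (Fin nx) ℝ) {N : ℕ}
    {G : (Fin N → Fin ny → ℝ) →ₗ[ℝ] (Fin nx → ℝ)}
    (hG : ∀ x, G (fun k => C.mulVec ((A ^ (k : ℕ)).mulVec x)) = x) {b : ℝ} (hb : 0 ≤ b) :
    ∃ β : ℝ, ∀ x₀ v w, ‖x₀‖ ≤ b → (∀ t, ‖v t‖ ≤ b) → (∀ t, ‖w t‖ ≤ b) →
      ∀ t, ‖observer A G (plantOutput A C x₀ v w) t - plantState A x₀ v t‖ ≤ β := by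
  obtain ⟨M, hM, hA⟩ := exists_one_le_norm_mulVec_le A
  have hM0 : 0 ≤ M := by linarith
  obtain ⟨cG, hcG, hGb⟩ := exists_norm_le_mul G
  obtain ⟨cC, hcC, hCb⟩ := exists_norm_le_mul (Matrix.toLin' C)
  refine ⟨max (M ^ N * (cG * (cC * (b * N * M ^ N) + b)) + b * N * M ^ N)
    (b * N * M ^ N + M ^ N * b), fun x₀ v w hx₀ hv hw t => ?_⟩
  rw [observer]
  split_ifs with hN
  · refine le_trans ?_ (le_max_left _ _)
    obtain ⟨s, rfl⟩ := Nat.exists_eq_add_of_le' hN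
    rw [Nat.add_sub_cancel]
    set x := plantState A x₀ v s with hx
    let e : Fin N → Fin ny → ℝ := fun k =>
      C.mulVec (plantState A x₀ v (s + k) - (A ^ (k : ℕ)).mulVec x) + w (s + k)
    have hdecomp : (fun k : Fin N => plantOutput A C x₀ v w (s + k)) =
        (fun k : Fin N => C.mulVec ((A ^ (k : ℕ)).mulVec x)) + e := by
      funext k
      simp only [e, plantOutput, Pi.add_apply, Matrix.mulVec_sub]
      abel
    have he : ‖e‖ ≤ cC * (b * N * M ^ N) + b := by
      rw [pi_norm_le_iff_of_nonneg (by positivity)]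
      intro k
      refine (norm_add_le _ _).trans (add_le_add ((hCb _).trans ?_) (hw _))
      gcongr
      refine (norm_plantState_add_sub_le hM hA hb hv s k).trans ?_
      have := k.2.le
      gcongr
    rw [hdecomp, map_add, hG, Matrix.mulVec_add]
    have h1 := norm_plantState_add_sub_le hM hA hb hv s N (x₀ := x₀)
    rw [← hx, norm_sub_rev] at h1
    have h2 : ‖(A ^ N).mulVec (G e)‖ ≤ M ^ N * (cG * (cC * (b * N * M ^ N) + b)) := by
      refine (norm_pow_mulVec_le hM0 hA _ _).trans ?_
      gcongr
      exact (hGb e).trans (by gcongr)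
    have h3 : (A ^ N).mulVec x + (A ^ N).mulVec (G e) - plantState A x₀ v (s + N) =
        (A ^ N).mulVec (G e) + ((A ^ N).mulVec x - plantState A x₀ v (s + N)) := by abel
    rw [h3]
    exact (norm_add_le _ _).trans (add_le_add h2 h1)
  · refine le_trans ?_ (le_max_right _ _)
    rw [zero_sub, norm_neg]
    have h1 := norm_plantState_add_sub_le hM hA hb hv 0 t (x₀ := x₀)
    rw [zero_add] at h1
    have h2 := norm_pow_mulVec_le hM0 hA t (plantState A x₀ v 0)
    have h3 : plantState A x₀ v t = (plantState A x₀ v t - (A ^ t).mulVec (plantState A x₀ v 0)) +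
      (A ^ t).mulVec (plantState A x₀ v 0) := by abel
    rw [h3]
    have htN : t ≤ N := by omega
    refine (norm_add_le _ _).trans (add_le_add (h1.trans ?_) (h2.trans ?_))
    · gcongr
    · exact mul_le_mul (by gcongr) hx₀ (norm_nonneg _) (by positivity)

/-- A linear system all of whose eigenvalues lie in the open unit disc has bounded response to
bounded inputs. -/
theorem exists_bound_of_stable {a : ℕ} {M : Matrix (Fin a) (Fin a) ℝ}
    (hM : ∀ z ∈ eigenvalues M, ‖z‖ < 1) {b : ℝ} (hb : 0 ≤ b) :
    ∃ β : ℝ, ∀ u d : ℕ → Fin a → ℝ, ‖u 0‖ ≤ b → (∀ t, ‖d t‖ ≤ b) →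
      (∀ t, u (t + 1) = M.mulVec (u t) + d t) → ∀ t, ‖u t‖ ≤ β := by
  -- There are finitely many eigenvalues, so one `ρ < 1` serves all.
  obtain ⟨ρ, hρ0, hρ1, hρ⟩ : ∃ ρ : ℝ, 0 < ρ ∧ ρ < 1 ∧ ∀ z ∈ eigenvalues M, ‖z‖ < ρ := by
    generalize eigenvalues M = s at hM
    induction s using Multiset.induction_on with
    | empty => exact ⟨1 / 2, by norm_num, by norm_num, by simp⟩
    | cons z s ih =>
      obtain ⟨ρ, h0, h1, h⟩ := ih fun w hw => hM w (by simp [hw])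
      obtain ⟨ρ', h2, h3⟩ := exists_between (max_lt h1 (hM z (by simp)))
      refine ⟨ρ', h0.trans ((le_max_left _ _).trans_lt h2), h3, fun w hw => ?_⟩
      rcases Multiset.mem_cons.1 hw with rfl | hw
      · exact (le_max_right _ _).trans_lt h2
      · exact (h w hw).trans ((le_max_left _ _).trans_lt h2)
  obtain ⟨c, hc, hcb⟩ := exists_norm_pow_mulVec_le M hρ0 hρ
  have hρ' : 0 < 1 - ρ := by linarith
  set K := c * b / (1 - ρ) with hK
  have hK1 : K * ρ + c * b = K := by rw [hK]; field_simp; ring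
  have hK0 : 0 ≤ K := by positivity
  refine ⟨K, fun u d hu hd hud t => ?_⟩
  -- Bounding all `M ^ j u(t)` at once makes the induction close: `K` is the fixed point of `K ↦ K *
  -- ρ + c * b`.
  suffices key : ∀ j, ‖(M ^ j).mulVec (u t)‖ ≤ K * ρ ^ j by simpa using key 0
  induction t with
  | zero =>
    intro j
    calc _ ≤ c * ρ ^ j * ‖u 0‖ := hcb j _
      _ ≤ c * ρ ^ j * b := by gcongr
      _ = (c * b) * ρ ^ j := by ring
      _ ≤ K * ρ ^ j := by gcongr; nlinarith
  | succ t ih =>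
    intro j
    rw [hud, Matrix.mulVec_add, Matrix.mulVec_mulVec, ← pow_succ]
    calc _ ≤ K * ρ ^ (j + 1) + c * ρ ^ j * b :=
          (norm_add_le _ _).trans (add_le_add (ih (j + 1)) ((hcb j _).trans (by gcongr; exact hd t)))
      _ = (K * ρ + c * b) * ρ ^ j := by ring
      _ = K * ρ ^ j := by rw [hK1]

end Plant

/-- Causal messages, sent blockwise by a zero-error code, reach the estimator without error. -/
theorem exists_coderEstimator_of_block_code {X Y S M : Type*} [Nonempty M]
    {ch : FiniteStateChannel X Y S} {n : ℕ} (hn : 0 < n) {w : M → Fin n → X}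
    (hw : ∀ a b y, ch.CanOutput (w a) y → ch.CanOutput (w b) y → a = b)
    {msg : (ℕ → Fin ny → ℝ) → ℕ → M}
    (hmsg : ∀ y y' k, (∀ i ≤ k * n, y i = y' i) → msg y k = msg y' k)
    {est : (ℕ → M) → ℕ → Fin nx → ℝ}
    (hest : ∀ μ μ' t, (∀ k, (k + 1) * n ≤ t → μ k = μ' k) → est μ t = est μ' t) :
    ∃ K : CoderEstimator nx ny X Y, ∀ y r, ch.CanOutputSeq (K.input y) r →
      ∀ t, K.estimate r (t + 1) = est (msg y) (t + 1) := by
  classical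
  let dec : (ℕ → Y) → ℕ → M := fun r k =>
    if h : ∃ c, ch.CanOutput (w c) (fun i : Fin n => r (k * n + i)) then h.choose
    else Classical.arbitrary M
  -- Message `k` occupies times `k * n, …, k * n + n - 1`, so it may use outputs up to time `k * n`.
  -- Padding of unavailable data by `0` or by `min i t` is harmless, as `est` reads only completed
  -- blocks.
  let K : CoderEstimator nx ny X Y :=
    { coder := fun t y => w (msg (fun i => if h : i < t + 1 then y ⟨i, h⟩ else 0) (t / n))
        ⟨t % n, Nat.mod_lt _ hn⟩
      estimator := fun t r => est (dec fun i => r ⟨min i t, by omega⟩) (t + 1) }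
  have hinput : ∀ y t, K.input y t = w (msg y (t / n)) ⟨t % n, Nat.mod_lt _ hn⟩ := by
    intro y t
    have : msg (fun i => if h : i < t + 1 then y i else 0) (t / n) = msg y (t / n) := by
      refine hmsg _ _ _ fun i hi => ?_
      have : i < t + 1 := Nat.lt_succ_of_le (hi.trans (Nat.div_mul_le_self t n))
      simp [this]
    simp only [CoderEstimator.input, K]
    rw [this]
  refine ⟨K, fun y r hr t => ?_⟩
  have hdec : ∀ k, dec r k = msg y k := by
    intro k
    have hblock := hr.block (k * n) n
    have hin : (fun i : Fin n => K.input y (k * n + i)) = w (msg y k) := by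
      funext i
      rw [hinput]
      have h1 : (k * n + i) / n = k := by
        rw [add_comm, Nat.add_mul_div_right _ _ hn, Nat.div_eq_of_lt i.2, zero_add]
      have h2 : (k * n + i) % n = i := by
        rw [add_comm, Nat.add_mul_mod_self_right, Nat.mod_eq_of_lt i.2]
      simp only [h1, h2]
    rw [hin] at hblock
    have hex : ∃ c, ch.CanOutput (w c) (fun i : Fin n => r (k * n + i)) := ⟨_, hblock⟩
    simp only [dec, dif_pos hex]
    exact hw _ _ _ hex.choose_spec hblock
  simp only [CoderEstimator.estimate, K]
  refine hest _ _ _ fun k hk => ?_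
  rw [← hdec k]
  have : (fun i : Fin n => r (min (k * n + i) t)) = fun i : Fin n => r (k * n + i) := by
    funext i
    have h1 : (k + 1) * n = k * n + n := by ring
    rw [min_eq_left (by omega)]
  simp only [dec, this]

/-! ### Sufficiency: assembling the coder-estimator -/

theorem exists_uniformlyBoundedErrors {X Y S : Type*} [Fintype X]
    {A : Matrix (Fin nx) (Fin nx) ℝ} {C : Matrix (Fin ny) (Fin nx) ℝ} (hobs : IsObservable C A)
    {ch : FiniteStateChannel X Y S} (hC₀ : 0 < ch.zeroErrorCapacity)
    (hlt : linEntropy (Fintype.card X) A < ch.zeroErrorCapacity) :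
    ∃ K : CoderEstimator nx ny X Y, K.UniformlyBoundedErrors A C ch := by
  have hq := FiniteStateChannel.one_lt_card_of_zeroErrorCapacity_pos hC₀
  have hq' : (1 : ℝ) < Fintype.card X := by exact_mod_cast hq
  obtain ⟨a, b, Au, As, L, hL, hch, hu, hs⟩ := exists_unstable_stable_decomposition A
  rw [linEntropy_eq_logb_det hch hu hs] at hlt
  have hdet := one_le_abs_det hu
  rw [FiniteStateChannel.zeroErrorCapacity] at hlt
  have hent : 0 ≤ Real.logb (Fintype.card X) |Au.det| := Real.logb_nonneg hq' hdet
  obtain ⟨ρ, ⟨m, F, hF, rfl⟩, hρ⟩ := exists_lt_of_lt_csSup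
    (by exact ⟨_, 0, ∅, fun x hx => by simp at hx, rfl⟩) hlt
  have hFdet : |Au.det| ^ (m + 1) < F.card := by
    rw [lt_div_iff₀ (by positivity)] at hρ
    have hFpos : (0 : ℝ) < F.card := by
      rcases F.card.eq_zero_or_pos with h0 | h0
      · rw [h0] at hρ
        simp only [Nat.cast_zero, Real.logb_zero] at hρ
        nlinarith
      · exact_mod_cast h0
    rw [← Real.logb_lt_logb_iff hq' (by positivity) hFpos, Real.logb_pow]
    push_cast
    linarith
  obtain ⟨j, T, hj, hTcard, hnet⟩ := exists_half_net_pow hu hFdet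
  obtain ⟨w, hw⟩ := hF.exists_block_code j (Option T) (by simpa using hTcard)
  obtain ⟨N, G, hG⟩ := hobs.exists_reconstruction
  set n := j * (m + 1) with hn
  have hn0 : 0 < n := by positivity
  let B : (Fin a → ℝ) →ₗ[ℝ] (Fin a → ℝ) := Matrix.toLin' (Au ^ n)
  obtain ⟨MB, hMB, hB⟩ := exists_one_le_norm_mulVec_le (Au ^ n)
  let P : (Fin nx → ℝ) →ₗ[ℝ] (Fin a → ℝ) := LinearMap.fst ℝ _ _ ∘ₗ L.toLinearMap
  let R : (Fin nx → ℝ) →ₗ[ℝ] (Fin b → ℝ) := LinearMap.snd ℝ _ _ ∘ₗ L.toLinearMap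
  have hP : ∀ x, P (A.mulVec x) = Au.mulVec (P x) := fun x => by simp [P, hL]
  have hR : ∀ x, R (A.mulVec x) = As.mulVec (R x) := fun x => by simp [R, hL]
  have hPow := apply_pow_mulVec hP
  let J : (Fin a → ℝ) → (Fin nx → ℝ) := fun u => L.symm (u, 0)
  let xs : (ℕ → Fin ny → ℝ) → ℕ → Fin a → ℝ := fun y k => P (observer A G y (k * n))
  obtain ⟨K, hK⟩ := exists_coderEstimator_of_block_code (nx := nx) (ny := ny) hn0 hw
    (msg := fun y => quantizerMessage B (4 * MB) T (xs y))
    (fun y y' k h => quantizerMessage_congr _ _ _ fun i hi => by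
      simp only [xs]
      rw [observer_congr A G fun l hl => h l (hl.le.trans (Nat.mul_le_mul_right _ hi))])
    -- The estimate at the last block start has stable coordinate zero and is propagated by `A`
    -- within the block.
    (est := fun μ t => (A ^ (t % n)).mulVec (J (quantizerState B (4 * MB) μ (t / n)).1))
    (fun μ μ' t h => by
      rw [quantizerState_congr B (4 * MB) fun i hi => h i
        ((Nat.mul_le_mul_right _ hi).trans (Nat.div_mul_le_self t n))])
  -- Noise bounds appear only after `K` is fixed, which is why the quantizer must be adaptive.
  refine ⟨K, fun NV NW ⟨⟨bv, hbv⟩, _⟩ ⟨⟨bw, hbw⟩, _⟩ => ⟨1, one_pos, fun I hI => ?_⟩⟩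
  obtain ⟨β₀, hβ₀1, hβ₀v, hβ₀w⟩ : ∃ β₀ : ℝ, 1 ≤ β₀ ∧ bv ≤ β₀ ∧ bw ≤ β₀ :=
    ⟨max 1 (max bv bw), le_max_left _ _, (le_max_left _ _).trans (le_max_right _ _),
      (le_max_right _ _).trans (le_max_right _ _)⟩
  have hβ₀ : 0 ≤ β₀ := by linarith
  obtain ⟨M, hM, hA⟩ := exists_one_le_norm_mulVec_le A
  have hM0 : 0 ≤ M := by linarith
  obtain ⟨cP, hcP, hPb⟩ := exists_norm_le_mul P
  obtain ⟨cR, hcR, hRb⟩ := exists_norm_le_mul R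
  obtain ⟨cL, hcL, hLb⟩ := exists_norm_le_mul L.symm.toLinearMap
  obtain ⟨βo, hβo⟩ := observer_bounded A C hG hβ₀
  -- The terms cover the observer error after a step, the propagated error from before it, the noise
  -- accumulated over a block, and the initial state.
  obtain ⟨βq, hβq⟩ := quantizerRun_bounded (B := B) hMB hB hnet
    (cP * (|βo| + M ^ n * |βo| + β₀ * n * M ^ n + β₀))
  obtain ⟨βs, hβs⟩ := exists_bound_of_stable hs (b := cR * β₀) (by positivity)
  set βk := cL * max (cP * |βo| + |βq|) |βs| with hβk
  have hβk0 : 0 ≤ βk := by positivity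
  refine ⟨β₀ * n * M ^ n + M ^ n * βk + β₀, fun x₀ hx₀ v hv w hw r hr t => ?_⟩
  have hx₀ : ‖x₀‖ ≤ β₀ := by
    have := hI hx₀
    rw [mem_closedBall_zero_iff] at this
    linarith
  have hv' : ∀ t, ‖v t‖ ≤ β₀ := fun t => (hbv v hv t).trans hβ₀v
  have hw' : ∀ t, ‖w t‖ ≤ β₀ := fun t => (hbw w hw t).trans hβ₀w
  rcases t with _ | t
  · simp only [CoderEstimator.estimate, plantState, zero_sub, norm_neg]
    have h1 : 0 ≤ β₀ * n * M ^ n := by positivity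
    have h2 : 0 ≤ M ^ n * βk := by positivity
    linarith
  rw [hK _ _ hr t]
  simp only [quantizerState_message]
  set y := plantOutput A C x₀ v w with hy
  set k := (t + 1) / n with hk
  set i := (t + 1) % n with hi
  have hin : i ≤ n := (Nat.mod_lt _ hn0).le
  have hti : t + 1 = k * n + i := by rw [hk, hi, mul_comm]; exact (Nat.div_add_mod _ _).symm
  rw [hti]
  have hobsb : ∀ t, ‖observer A G y t - plantState A x₀ v t‖ ≤ |βo| := fun t =>
    (hβo x₀ v w hx₀ hv' hw' t).trans (le_abs_self _)
  have hq0 : ‖xs y 0‖ ≤ cP * (|βo| + M ^ n * |βo| + β₀ * n * M ^ n + β₀) := by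
    refine (hPb _).trans ?_
    gcongr
    have h1 := hobsb (0 * n)
    have h2 : plantState A x₀ v (0 * n) = x₀ := by rw [zero_mul]; rfl
    rw [h2] at h1
    have h3 := norm_le_norm_sub_add (observer A G y (0 * n)) x₀
    have h4 : 0 ≤ M ^ n * |βo| + β₀ * n * M ^ n := by positivity
    linarith
  have hqstep : ∀ k, ‖xs y (k + 1) - B (xs y k)‖ ≤
      cP * (|βo| + M ^ n * |βo| + β₀ * n * M ^ n + β₀) := by
    intro k
    have h1 : B (xs y k) = P ((A ^ n).mulVec (observer A G y (k * n))) := (hPow n _).symm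
    simp only [h1, xs, ← map_sub]
    refine (hPb _).trans ?_
    gcongr
    have h2 := hobsb ((k + 1) * n)
    have h3 := norm_pow_mulVec_le hM0 hA n (observer A G y (k * n) - plantState A x₀ v (k * n))
    have h4 : M ^ n * ‖observer A G y (k * n) - plantState A x₀ v (k * n)‖ ≤ M ^ n * |βo| := by
      gcongr
      exact hobsb _
    have h5 := norm_plantState_add_sub_le hM hA hβ₀ hv' (k * n) n (x₀ := x₀)
    rw [show k * n + n = (k + 1) * n by ring] at h5
    have h6 : observer A G y ((k + 1) * n) - (A ^ n).mulVec (observer A G y (k * n)) =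
        (observer A G y ((k + 1) * n) - plantState A x₀ v ((k + 1) * n)) +
        (plantState A x₀ v ((k + 1) * n) - (A ^ n).mulVec (plantState A x₀ v (k * n))) -
        (A ^ n).mulVec (observer A G y (k * n) - plantState A x₀ v (k * n)) := by
      rw [Matrix.mulVec_sub]; abel
    rw [h6]
    refine (norm_sub_le _ _).trans ?_
    have h7 := norm_add_le (observer A G y ((k + 1) * n) - plantState A x₀ v ((k + 1) * n))
      (plantState A x₀ v ((k + 1) * n) - (A ^ n).mulVec (plantState A x₀ v (k * n)))
    linarith
  have hz := hβq (xs y) hq0 hqstep k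
  set z := (quantizerRun B (4 * MB) T (xs y) k).1 with hzdef
  set x := plantState A x₀ v (k * n) with hx
  have hstable : ‖R x‖ ≤ βs := by
    refine hβs (fun t => R (plantState A x₀ v t)) (fun t => R (v t)) ?_ ?_ ?_ (k * n)
    · exact (hRb _).trans (by gcongr; exact hx₀)
    · exact fun t => (hRb _).trans (by gcongr; exact hv' t)
    · intro t
      simp only [plantState, map_add, hR]
  have hblock : ‖J z - x‖ ≤ βk := by
    have h1 : J z - x = L.symm (z - P x, -R x) := by
      apply L.injective
      rw [map_sub, L.apply_symm_apply, L.apply_symm_apply]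
      ext <;> simp [P, R]
    rw [h1]
    refine (hLb _).trans ?_
    rw [hβk]
    gcongr
    rw [Prod.norm_def]
    refine max_le_max ?_ (by simpa using hstable.trans (le_abs_self _))
    have h2 : z - P x = P (observer A G y (k * n) - x) - (xs y k - z) := by
      simp only [xs, map_sub]; abel
    rw [h2]
    refine (norm_sub_le _ _).trans (add_le_add ((hPb _).trans ?_) (hz.trans (le_abs_self _)))
    gcongr
    exact hobsb _
  have h1 := norm_plantState_add_sub_le hM hA hβ₀ hv' (k * n) i (x₀ := x₀)
  have h2 := norm_pow_mulVec_le hM0 hA i (J z - x)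
  have h3 : (A ^ i).mulVec (J z) - plantState A x₀ v (k * n + i) =
      (A ^ i).mulVec (J z - x) - (plantState A x₀ v (k * n + i) - (A ^ i).mulVec x) := by
    rw [Matrix.mulVec_sub]; abel
  rw [h3]
  refine (norm_sub_le _ _).trans ?_
  have h4 : β₀ * i * M ^ i ≤ β₀ * n * M ^ n := by gcongr
  have h5 : M ^ i * ‖J z - x‖ ≤ M ^ n * βk := by gcongr
  linarith

end BoundedEstimation

theorem theorem2 {nx ny : ℕ} {X Y S : Type*} [Fintype X] [Finite S] [Nonempty S]
    (A : Matrix (Fin nx) (Fin nx) ℝ) (C : Matrix (Fin ny) (Fin nx) ℝ)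
    (hobs : IsObservable C A)
    (hunstable : ∃ z ∈ BoundedEstimation.eigenvalues A, 1 < ‖z‖)
    (ch : FiniteStateChannel X Y S) (hC₀ : 0 < ch.zeroErrorCapacity) :
    ((∃ K : CoderEstimator nx ny X Y, K.UniformlyBoundedErrors A C ch) →
        linEntropy (Fintype.card X) A ≤ ch.zeroErrorCapacity) ∧
      (linEntropy (Fintype.card X) A < ch.zeroErrorCapacity →
        ∃ K : CoderEstimator nx ny X Y, K.UniformlyBoundedErrors A C ch) :=
  ⟨fun ⟨_, hK⟩ => linEntropy_le_zeroErrorCapacity hC₀ hK,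
    fun hlt => exists_uniformlyBoundedErrors hobs hC₀ hlt⟩
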